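/- Let $n\ge 1$, $q\ge 2$ and $\tau\ge 1$ be integers. Let $\mathbb H(n,q)=\{0,\dots,q-1\}^n$ with Hamming distance $d$, put $\langle x,y\rangle=1-2d(x,y)/n$ and $T_n=\{-1+2i/n: 0\le i\le n\}$. For a function $h$ on $[-1,1)$ and a nonempty code $C\subset\mathbb H(n,q)$ let $$E(n,C;h)=\frac1{|C|}\sum_{x,y\in C,\ x\ne y}h(\langle x,y\rangle).$$ A code $C$ is a $\tau$-design if, for some integer $\lambda\ge 1$, $|C|=\lambda q^\tau$ and every choice of $\tau$ distinct columns of the $|C|\times n$ matrix whose rows are the codewords contains each word of $\mathbb H(\tau,q)$ exactly $\lambda$ times as a row. Let $\mathcal L(n,M,\tau;h)=\min E(n,C;h)$ over the $\tau$-designs $C\subset\mathbb H(n,q)$ with $|C|=M$, and $\mathcal L(n,M,\tau;h)=\infty$ if there are none. For $k\ge 0$ let $$R(n,2k)=\sum_{i=0}^{k}\binom ni(q-1)^i,\qquad R(n,2k-1)=q\sum_{i=0}^{k-1}\binom{n-1}i(q-1)^i .$$ Let $Q_i(t)=K_i(z)/\big((q-1)^i\binom ni\big)$, $z=n(1-t)/2$,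 where $K_i(z)=\sum_{j=0}^i(-1)^j(q-1)^{i-j}\binom zj\binom{n-z}{i-j}$, $0\le i\le n$, be the normalized Krawtchouk polynomials. For a real polynomial $f$ let $f_0$ be the coefficient of $Q_0$ in the unique expansion $f(t)=\sum_{i=0}^n f_iQ_i(t)$, $t\in T_n$ (an identity of polynomials if $\deg f\le n$). Let $h$ be absolutely monotone on $[-1,1)$, that is, $h$ and all its derivatives exist and are nonnegative on $[-1,1)$. (a) Let $\tau=2k-1$ and let $M$ be an integer with $R(n,2k-1)<M\le R(n,2k)$. There are unique real numbers $-1<\alpha_0<\dots<\alpha_{k-1}<1$ and $\rho_0,\dots,\rho_{k-1}>0$ such that $f_0=\frac{f(1)}M+\sum_{i=0}^{k-1}\rho_if(\alpha_i)$ for all real polynomials $f$ of degree at most $2k-1$, and $$\mathcal L(n,M,\tau;h)\ \ge\ M\sum_{i=0}^{k-1}\rho_i h(\alpha_i).$$ (b) Let $\tau=2k$ and let $M$ be an integer with $R(n,2k)<M\le R(n,2k+1)$. There are unique real numbers $-1=\beta_0<\beta_1<\dots<\beta_k<1$ and $\gamma_0,\dots,\gamma_k>0$ such that $f_0=\frac{f(1)}M+\sum_{i=0}^{k}\gamma_if(\beta_i)$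 for all real polynomials $f$ of degree at most $2k$, and $$\mathcal L(n,M,\tau;h)\ \ge\ M\sum_{i=0}^{k}\gamma_i h(\beta_i).$$ Moreover, in both cases, if $\mathcal L(n,M,\tau;h)<\infty$, then the bound cannot be improved by polynomials of degree at most $\tau$ lying below $h$: its right-hand side equals the maximum value of $f_0M-f(1)$ over all real polynomials $f$ of degree at most $\tau$ with $f(t)\le h(t)$ for every $t\in[-1,1)$. -/

import Mathlib

open Finset Polynomial

noncomputable section

namespace HammingEnergy

/-- The Hamming space `H(n,q)`: words of length `n` over an alphabet of `q` symbols. -/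
abbrev HSpace (n q : ℕ) : Type := Fin n → Fin q

/-- The "inner product" `⟨x,y⟩ = 1 - 2 d(x,y) / n`, with `d` the Hamming distance. -/
def ip {n q : ℕ} (x y : HSpace n q) : ℝ := 1 - 2 * (hammingDist x y : ℝ) / n

/-- The `h`-energy `E(n,C;h) = |C|⁻¹ ∑_{x ≠ y ∈ C} h(⟨x,y⟩)` of a code `C`. -/
def energy {n q : ℕ} (h : ℝ → ℝ) (C : Finset (HSpace n q)) : ℝ :=
  (1 / (#C : ℝ)) * ∑ x ∈ C, ∑ y ∈ C with x ≠ y, h (ip x y)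

/-- `C ⊆ H(n,q)` is a `τ`-design: for some positive index `lam` one has `|C| = lam * q ^ τ`, and
every choice of `τ` distinct columns of the matrix of codewords contains every word of `H(τ,q)`
exactly `lam` times as a row. -/
def IsDesign {n q : ℕ} (τ : ℕ) (C : Finset (HSpace n q)) : Prop :=
  ∃ lam : ℕ, 0 < lam ∧ #C = lam * q ^ τ ∧
    ∀ (e : Fin τ ↪ Fin n) (y : HSpace τ q), #{x ∈ C | ∀ j, x (e j) = y j} = lam

/-- The minimal `h`-energy `L(n,M,τ;h)` of an `M`-point `τ`-design in `H(n,q)`. There are finitely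
many codes, so the infimum is a minimum unless there is no such design, when it is `⊤ = ∞`. -/
def minDesignEnergy (n q M τ : ℕ) (h : ℝ → ℝ) : EReal :=
  ⨅ C ∈ {C : Finset (HSpace n q) | #C = M ∧ IsDesign τ C}, (energy h C : EReal)

/-- The Rao bound: `R(n,2k-1) = q ∑_{i=0}^{k-1} (n-1 choose i) (q-1)^i` and
`R(n,2k) = ∑_{i=0}^{k} (n choose i) (q-1)^i`. -/
def raoBound (n q τ : ℕ) : ℕ :=
  if Even τ then ∑ i ∈ range (τ / 2 + 1), n.choose i * (q - 1) ^ i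
  else q * ∑ i ∈ range ((τ + 1) / 2), (n - 1).choose i * (q - 1) ^ i

/-- The Krawtchouk polynomial `K_i^{(n,q)}(z)`; `Ring.choose` is the generalized binomial
coefficient `z (z-1) ⋯ (z-j+1) / j!`. -/
def krawtchouk (n q i : ℕ) (z : ℝ) : ℝ :=
  ∑ j ∈ range (i + 1),
    (-1) ^ j * ((q : ℝ) - 1) ^ (i - j) * Ring.choose z j * Ring.choose ((n : ℝ) - z) (i - j)

/-- The normalized Krawtchouk polynomial `Q_i^{(n,q)}(t) = K_i^{(n,q)}(n (1 - t) / 2) / r_i`, where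
`r_i = (q-1)^i (n choose i)`. -/
def normKrawtchouk (n q i : ℕ) (t : ℝ) : ℝ :=
  krawtchouk n q i (n * (1 - t) / 2) / (((q : ℝ) - 1) ^ i * n.choose i)

/-- The set `T_n` of the inner products `t_i = -1 + 2 i / n`, `0 ≤ i ≤ n`. -/
def innerProducts (n : ℕ) : Set ℝ := {t | ∃ i : ℕ, i ≤ n ∧ t = -1 + 2 * (i : ℝ) / n}

/-- `f = ∑_{i=0}^n c_i Q_i^{(n,q)}` on `T_n`. As `T_n` has `n + 1` points, for `deg f ≤ n` this says
that the two sides are equal as polynomials. -/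
def IsKrawtchoukExpansion (n q : ℕ) (f : ℝ[X]) (c : Fin (n + 1) → ℝ) : Prop :=
  ∀ t ∈ innerProducts n, f.eval t = ∑ i, c i * normKrawtchouk n q i t

section WellDefined

lemma coeff_one_add_C_mul_X_pow (a : ℝ) (m j : ℕ) :
    ((1 + C a * X : ℝ[X]) ^ m).coeff j = a ^ j * m.choose j := by
  have : (1 + C a * X : ℝ[X]) ^ m = ((1 + X : ℝ[X]) ^ m).comp (C a * X) := by simp
  rw [this, comp_C_mul_X_coeff, coeff_one_add_X_pow, mul_comm]

/-- The generating polynomial of the values `K_i(z)`, `0 ≤ i ≤ n`, at an integer `z`. -/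
def genPoly (n q z : ℕ) : ℝ[X] :=
  (1 + C (-1) * X) ^ z * (1 + C ((q : ℝ) - 1) * X) ^ (n - z)

lemma krawtchouk_natCast {n z : ℕ} (q i : ℕ) (hz : z ≤ n) :
    krawtchouk n q i z = (genPoly n q z).coeff i := by
  rw [genPoly, coeff_mul, Nat.sum_antidiagonal_eq_sum_range_succ_mk, krawtchouk]
  refine sum_congr rfl fun j _ => ?_
  rw [coeff_one_add_C_mul_X_pow, coeff_one_add_C_mul_X_pow, ← Nat.cast_sub hz,
    Ring.choose_natCast, Ring.choose_natCast]
  ring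

lemma eval_genPoly {n z : ℕ} (q : ℕ) (hz : z ≤ n) (x : ℝ) :
    (genPoly n q z).eval x = ∑ j ∈ range (n + 1), krawtchouk n q j z * x ^ j := by
  have hd : (genPoly n q z).natDegree < n + 1 := by
    have h1 : (1 + C (-1) * X : ℝ[X]).natDegree ≤ 1 := by compute_degree
    have h2 : (1 + C ((q : ℝ) - 1) * X : ℝ[X]).natDegree ≤ 1 := by compute_degree
    have := natDegree_mul_le_of_le (natDegree_pow_le_of_le z h1)
      (natDegree_pow_le_of_le (n - z) h2)
    rw [genPoly]; omega
  rw [eval_eq_sum_range' hd]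
  exact sum_congr rfl fun j _ => by rw [krawtchouk_natCast q j hz]

/-- The matrix of the values `K_i(j)` squares to `q^n` times the identity. -/
lemma sum_krawtchouk_mul {n q z : ℕ} (hq : 2 ≤ q) (i : ℕ) (hz : z ≤ n) :
    ∑ j ∈ range (n + 1), krawtchouk n q i j * krawtchouk n q j z
      = if i = z then (q : ℝ) ^ n else 0 := by
  have key : ∑ j ∈ range (n + 1), C (krawtchouk n q j z) * genPoly n q j
      = C ((q : ℝ) ^ n) * X ^ z := by
    refine eq_of_infinite_eval_eq _ _ ((Set.Ici_infinite (0 : ℝ)).mono fun x hx => ?_)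
    have hx : 0 ≤ x := hx
    have hq' : (2 : ℝ) ≤ q := by exact_mod_cast hq
    have hb : 0 < 1 + ((q : ℝ) - 1) * x := by nlinarith
    set b := 1 + ((q : ℝ) - 1) * x with hbd
    have e := eval_genPoly q hz ((1 - x) / b)
    have e1 : 1 + -1 * ((1 - x) / b) = q * x / b := by field_simp; rw [hbd]; ring
    have e2 : 1 + ((q : ℝ) - 1) * ((1 - x) / b) = q / b := by field_simp; rw [hbd]; ring
    simp only [genPoly, eval_mul, eval_pow, eval_add, eval_one, eval_C, eval_X, e1, e2] at e
    have e3 : (q * x / b) ^ z * (q / b) ^ (n - z) * b ^ n = (q : ℝ) ^ n * x ^ z := by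
      obtain ⟨m, rfl⟩ := Nat.exists_eq_add_of_le hz
      rw [Nat.add_sub_cancel_left, div_pow, div_pow, pow_add b, mul_pow, pow_add]
      field_simp
    simp only [Set.mem_ofPred_eq, eval_finsetSum, genPoly, eval_mul, eval_pow, eval_add, eval_one,
      eval_C, eval_X]
    rw [← e3, e, sum_mul]
    refine sum_congr rfl fun j hj => ?_
    obtain ⟨m, hm⟩ := Nat.exists_eq_add_of_le (Nat.lt_succ_iff.1 (mem_range.1 hj))
    rw [hm, Nat.add_sub_cancel_left, pow_add, div_pow, ← hbd]
    field_simp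
    ring
  have := congrArg (fun p => coeff p i) key
  simp only [finsetSum_coeff, coeff_C_mul, coeff_X_pow] at this
  rw [mul_ite, mul_one, mul_zero] at this
  rw [← this]
  refine sum_congr rfl fun j hj => ?_
  rw [krawtchouk_natCast q i (Nat.lt_succ_iff.1 (mem_range.1 hj)), mul_comm]

/-- Every polynomial has exactly one Krawtchouk expansion. -/
theorem existsUnique_krawtchoukExpansion {n q : ℕ} (hn : 0 < n) (hq : 2 ≤ q) (f : ℝ[X]) :
    ∃! c : Fin (n + 1) → ℝ, IsKrawtchoukExpansion n q f c := by
  have hn' : (n : ℝ) ≠ 0 := by positivity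
  have hq0 : (q : ℝ) ^ n ≠ 0 := by positivity
  have hq1 : (0 : ℝ) < (q : ℝ) - 1 := by
    have : (2 : ℝ) ≤ q := by exact_mod_cast hq
    linarith
  set r : Fin (n + 1) → ℝ := fun i => ((q : ℝ) - 1) ^ (i : ℕ) * n.choose i with hr
  have hr0 : ∀ i, r i ≠ 0 := fun i => by
    have : 0 < n.choose i := Nat.choose_pos (Nat.lt_succ_iff.1 i.2)
    simp only [hr]; positivity
  set g : Fin (n + 1) → ℝ := fun z => f.eval (1 - 2 * (z : ℝ) / n) with hg
  have orth : ∀ i z : Fin (n + 1), ∑ j : Fin (n + 1), krawtchouk n q i j * krawtchouk n q j z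
      = if i = z then (q : ℝ) ^ n else 0 := fun i z => by
    have := sum_krawtchouk_mul hq i (Nat.lt_succ_iff.1 z.2)
    rw [← Fin.sum_univ_eq_sum_range
      (fun j => krawtchouk n q i (j : ℕ) * krawtchouk n q j (z : ℕ))] at this
    simpa [Fin.ext_iff] using this
  have iff1 : ∀ c, IsKrawtchoukExpansion n q f c ↔
      ∀ z : Fin (n + 1), g z = ∑ i, c i / r i * krawtchouk n q i z := by
    intro c
    have hz : ∀ z : Fin (n + 1), (n : ℝ) * (1 - (1 - 2 * (z : ℝ) / n)) / 2 = z := fun z => by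
      field_simp; ring
    have hs : ∀ z : Fin (n + 1), ∑ i, c i * normKrawtchouk n q i (1 - 2 * (z : ℝ) / n)
        = ∑ i, c i / r i * krawtchouk n q i z := fun z => by
      refine sum_congr rfl fun i _ => ?_
      rw [normKrawtchouk, hz]; simp only [hr]; ring
    constructor
    · intro H z
      rw [← hs]
      refine H _ ⟨n - z, Nat.sub_le _ _, ?_⟩
      rw [Nat.cast_sub (Nat.lt_succ_iff.1 z.2)]; field_simp; ring
    · rintro H t ⟨i, hi, rfl⟩
      have ht : -1 + 2 * (i : ℝ) / n
          = 1 - 2 * (((⟨n - i, by omega⟩ : Fin (n + 1)) : ℕ) : ℝ) / n := by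
        simp only [Nat.cast_sub hi]; field_simp; ring
      rw [ht, hs]
      exact H _
  refine ⟨fun i => r i * (((q : ℝ) ^ n)⁻¹ * ∑ z : Fin (n + 1), g z * krawtchouk n q z i),
    (iff1 _).2 fun z => ?_, fun c hc => ?_⟩
  · have h1 : ∀ i : Fin (n + 1), r i * (((q : ℝ) ^ n)⁻¹ * ∑ w : Fin (n + 1),
        g w * krawtchouk n q w i) / r i * krawtchouk n q i z
        = ((q : ℝ) ^ n)⁻¹ * ∑ w : Fin (n + 1),
          g w * (krawtchouk n q w i * krawtchouk n q i z) := fun i => by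
      rw [mul_div_cancel_left₀ _ (hr0 i), mul_assoc, sum_mul]
      simp only [mul_assoc]
    rw [sum_congr rfl fun i _ => h1 i, ← mul_sum, sum_comm]
    simp only [← mul_sum, orth]
    simp only [mul_ite, mul_zero, sum_ite_eq', mem_univ, if_true]
    field_simp
  · funext i
    have h2 := (iff1 c).1 hc
    simp only [h2, sum_mul]
    rw [sum_comm]
    simp only [mul_assoc, ← mul_sum, orth]
    have := hr0 i
    simp
    field_simp

end WellDefined

/-- The coefficients `f_0, …, f_n` of the Krawtchouk expansion of the polynomial `f`. -/
def krawtchoukCoeff (n q : ℕ) (f : ℝ[X]) : Fin (n + 1) → ℝ :=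
  Classical.epsilon (IsKrawtchoukExpansion n q f)

/-- For `n ≥ 1` and `q ≥ 2` the coefficients are the ones of the only Krawtchouk expansion. -/
theorem isKrawtchoukExpansion_iff {n q : ℕ} (hn : 0 < n) (hq : 2 ≤ q) (f : ℝ[X])
    (c : Fin (n + 1) → ℝ) : IsKrawtchoukExpansion n q f c ↔ c = krawtchoukCoeff n q f := by
  have H := existsUnique_krawtchoukExpansion hn hq f
  have hs : IsKrawtchoukExpansion n q f (krawtchoukCoeff n q f) := Classical.epsilon_spec H.exists
  exact ⟨fun h => H.unique h hs, fun h => h ▸ hs⟩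

/-- The nodes `-1 < α_0 < ⋯ < α_{k-1} < 1` and positive weights `ρ_0, …, ρ_{k-1}` of the quadrature
`f_0 = f(1) / M + ∑ ρ_i f(α_i)`, valid for all real polynomials of degree at most `2k-1`. -/
def IsOddQuadrature (n q M k : ℕ) (α ρ : Fin k → ℝ) : Prop :=
  StrictMono α ∧ (∀ i, α i ∈ Set.Ioo (-1 : ℝ) 1) ∧ (∀ i, 0 < ρ i) ∧
    ∀ f : ℝ[X], f.natDegree ≤ 2 * k - 1 →
      krawtchoukCoeff n q f 0 = f.eval 1 / M + ∑ i, ρ i * f.eval (α i)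

/-- The nodes `-1 = β_0 < β_1 < ⋯ < β_k < 1` and positive weights `γ_0, …, γ_k` of the quadrature
`f_0 = f(1) / M + ∑ γ_i f(β_i)`, valid for all real polynomials of degree at most `2k`. -/
def IsEvenQuadrature (n q M k : ℕ) (β γ : Fin (k + 1) → ℝ) : Prop :=
  StrictMono β ∧ β 0 = -1 ∧ (∀ i, β i < 1) ∧ (∀ i, 0 < γ i) ∧
    ∀ f : ℝ[X], f.natDegree ≤ 2 * k →
      krawtchoukCoeff n q f 0 = f.eval 1 / M + ∑ i, γ i * f.eval (β i)

/-- The values `f_0 M - f(1)` of the real polynomials `f` of degree at most `τ` with `f ≤ h` on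
`[-1,1)`. -/
def linearProgramValues (n q M τ : ℕ) (h : ℝ → ℝ) : Set ℝ :=
  {v | ∃ f : ℝ[X], f.natDegree ≤ τ ∧ (∀ t ∈ Set.Ico (-1 : ℝ) 1, f.eval t ≤ h t) ∧
    v = krawtchoukCoeff n q f 0 * M - f.eval 1}

end HammingEnergy

end

/-! With `z` the Hamming distance and `t = 1 - 2z/n`, orthogonality of the Krawtchouk matrix shows
that `f_0` is the mean of `f` over a binomial variable `z` with success probability `(q-1)/q`
(`krawtchoukCoeff_zero`). The functional to be represented is therefore `Λ f = f_0 - f(1)/M`, a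
binomial mean minus a point mass at `t = 1`, that is, at `z = 0`.

Everything rests on positivity of `Λ`. The kernel `∑_{i ≤ m} K_i` reproduces values at `0`, so
Cauchy–Schwarz bounds `p(1)²` by a Rao sum times the mean of `p²` (`sq_eval_zero_le`). Hence `M >
R(n,2k)` makes `Λ` positive on nonzero squares of polynomials of degree at most `k`. Multiplying the
density by `1 + t` removes one trial from the binomial law, which turns `M > R(n,2k-1)` into
positivity of `Λ((1+t)p²)` for `deg p < k`. The factor `1 - t` kills the point mass, so `Λ((1-t)p²)`
is positive whenever `p` has too few zeros. The upper bound on `M` enters only to force `k < n`.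

For odd strength, Gauss quadrature for `Λ` gives the nodes and weights; for even strength, Gauss
quadrature for `g ↦ Λ((1+t)g)` gives the nodes other than `-1` (`existsUnique_oddQuadrature`,
`existsUnique_evenQuadrature`). Hermite interpolation of `h`, double at inner nodes and simple at
`-1`, stays below `h`, because the remainder is a nonnegative divided difference times a nonnegative
product. On a `τ`-design, summing a polynomial of degree at most `τ` over a row of inner products
gives `|C| f_0`; this yields the energy bound for the interpolant. Any other feasible `f` has `f_0 M
- f(1) = M ∑ ρ_i f(α_i) ≤ M ∑ ρ_i h(α_i)`, which is optimality. -/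

noncomputable section

namespace HammingEnergy

/-! ### Gauss quadrature for a positive functional on real polynomials. -/

section GaussQuadrature

variable {Λ : ℝ[X] →ₗ[ℝ] ℝ} {k : ℕ}

/-- A functional that is positive on the squares of nonzero polynomials of degree less than `k`
has a monic orthogonal polynomial of degree `k`. -/
lemma exists_monic_orthogonal (hpos : ∀ p : ℝ[X], p ≠ 0 → p.degree < k → 0 < Λ (p * p)) :
    ∃ P : ℝ[X], P.Monic ∧ P.degree = k ∧ ∀ g : ℝ[X], g.degree < k → Λ (P * g) = 0 := by
  let B : degreeLT ℝ k →ₗ[ℝ] Module.Dual ℝ (degreeLT ℝ k) :=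
    LinearMap.mk₂ ℝ (fun p g => Λ (p * g)) (fun _ _ _ => by simp [add_mul])
      (fun _ _ _ => by simp) (fun _ _ _ => by simp [mul_add]) (fun _ _ _ => by simp)
  have : FiniteDimensional ℝ (degreeLT ℝ k) :=
    (degreeLTEquiv ℝ k).symm.finiteDimensional
  have hinj : Function.Injective B := by
    rw [injective_iff_map_eq_zero]
    rintro ⟨p, hp⟩ h
    by_contra hne
    have h1 := hpos p (fun h0 => hne (by ext1; exact h0)) (mem_degreeLT.1 hp)
    have h2 : Λ (p * p) = 0 := LinearMap.congr_fun h ⟨p, hp⟩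
    linarith
  have hsurj : Function.Surjective B :=
    (LinearMap.injective_iff_surjective_of_finrank_eq_finrank
      Subspace.dual_finrank_eq.symm).1 hinj
  -- Positivity makes the form `Λ(pg)` nondegenerate in finite dimension, so some `p` represents `g
  -- ↦ Λ(X^k g)`; then `X^k - p` is orthogonal to everything of degree below `k`.
  obtain ⟨⟨p, hp⟩, hB⟩ := hsurj
    ((Λ ∘ₗ LinearMap.mulLeft ℝ (X ^ k)) ∘ₗ (degreeLT ℝ k).subtype)
  rw [mem_degreeLT] at hp
  refine ⟨X ^ k - p, monic_X_pow_sub hp, ?_, fun g hg => ?_⟩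
  · rw [degree_sub_eq_left_of_degree_lt (by rwa [degree_X_pow]), degree_X_pow]
  · have h : Λ (p * g) = Λ (X ^ k * g) := LinearMap.congr_fun hB ⟨g, mem_degreeLT.2 hg⟩
    rw [sub_mul, map_sub, h, sub_self]

/-- An orthogonal polynomial is not divisible by a sum of two squares of a linear polynomial and a
constant. -/
lemma not_sq_add_sq_dvd (hpos : ∀ p : ℝ[X], p ≠ 0 → p.degree < k → 0 < Λ (p * p))
    {P : ℝ[X]} (hP : P.Monic) (hd : P.degree = k)
    (horth : ∀ g : ℝ[X], g.degree < k → Λ (P * g) = 0) (a b : ℝ) :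
    ¬ ((X - C a) * (X - C a) + C (b * b) ∣ P) := by
  rintro ⟨g, rfl⟩
  have hg : g ≠ 0 := by rintro rfl; simp at hP
  have hquad : ((X - C a) * (X - C a) + C (b * b) : ℝ[X]).degree = 2 := by
    rw [degree_add_eq_left_of_degree_lt]
    · rw [degree_mul, degree_X_sub_C]; rfl
    · rw [degree_mul, degree_X_sub_C]
      exact lt_of_le_of_lt degree_C_le (by decide)
  have hk : g.natDegree + 2 = k := by
    rw [degree_mul, hquad, degree_eq_natDegree hg] at hd
    norm_cast at hd
    omega
  have h1 : g.degree < k := by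
    rw [degree_eq_natDegree hg]; norm_cast; omega
  have h2 : ((X - C a) * g : ℝ[X]).degree < (k : WithBot ℕ) := by
    rw [degree_mul, degree_X_sub_C, degree_eq_natDegree hg]; norm_cast; omega
  -- Testing orthogonality against the cofactor `g` would make a positive square plus a nonnegative
  -- one equal to zero.
  have h3 : Λ (((X - C a) * (X - C a) + C (b * b)) * g * g)
      = Λ (((X - C a) * g) * ((X - C a) * g)) + b * b * Λ (g * g) := by
    rw [← smul_eq_mul (b * b), ← map_smul, ← map_add, smul_eq_C_mul]
    congr 1
    ring
  have h4 := hpos _ (mul_ne_zero (X_sub_C_ne_zero a) hg) h2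
  have h5 := hpos _ hg h1
  have := horth g h1
  nlinarith [mul_nonneg (mul_self_nonneg b) h5.le]

/-- The roots of an orthogonal polynomial are real and simple. -/
lemma exists_eq_prod_of_orthogonal
    (hpos : ∀ p : ℝ[X], p ≠ 0 → p.degree < k → 0 < Λ (p * p))
    {P : ℝ[X]} (hP : P.Monic) (hd : P.degree = k)
    (horth : ∀ g : ℝ[X], g.degree < k → Λ (P * g) = 0) :
    ∃ α : Fin k → ℝ, StrictMono α ∧ P = ∏ i, (X - C (α i)) := by
  have hndvd := not_sq_add_sq_dvd hpos hP hd horth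
  have hsplit : P.Splits := by
    rw [splits_iff_splits]
    right
    intro g hg hgP
    obtain ⟨z, hz⟩ := Complex.exists_root (f := g.map (algebraMap ℝ ℂ)) (by
      rw [degree_map]; exact hg.degree_pos)
    have hz' : aeval z g = 0 := by rwa [IsRoot.def, eval_map_algebraMap] at hz
    by_cases him : z.im = 0
    · have hroot : g.IsRoot z.re := by
        have hzr : z = algebraMap ℝ ℂ z.re := by
          apply Complex.ext <;> simp [him]
        rw [hzr, aeval_algebraMap_apply_eq_algebraMap_eval] at hz'
        simpa using hz'
      exact degree_eq_one_of_irreducible_of_root hg hroot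
    -- A nonreal root contributes the real quadratic factor `(X - Re z)² + (Im z)²`, excluded by
    -- `hndvd`. A repeated real root is excluded below by the same fact with `b = 0`.
    · exfalso
      refine hndvd z.re z.im (dvd_trans ?_ hgP)
      convert! g.quadratic_dvd_of_aeval_eq_zero_im_ne_zero hz' him using 1
      rw [Complex.sq_norm, Complex.normSq_apply]
      simp only [C_mul, C_add, map_ofNat]
      ring
  have hnodup : P.roots.Nodup := by
    rw [Multiset.nodup_iff_count_le_one]
    intro a
    by_contra! hlt
    rw [count_roots] at hlt
    refine hndvd a 0 ?_
    have := (le_rootMultiplicity_iff hP.ne_zero).1 hlt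
    simpa [pow_two] using this
  have hcard : #P.roots.toFinset = k := by
    rw [Multiset.toFinset_card_of_nodup hnodup, ← hsplit.natDegree_eq_card_roots]
    exact natDegree_eq_of_degree_eq_some hd
  refine ⟨P.roots.toFinset.orderEmbOfFin hcard, OrderEmbedding.strictMono _, ?_⟩
  conv_lhs => rw [hsplit.eq_prod_roots_of_monic hP]
  rw [← Finset.prod_image (f := fun a => X - C a) (s := univ)
    (g := P.roots.toFinset.orderEmbOfFin hcard) (by
      intro a _ b _ h; exact (OrderEmbedding.strictMono _).injective h)]
  have : univ.image (P.roots.toFinset.orderEmbOfFin hcard) = P.roots.toFinset := by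
    apply Finset.coe_injective
    simp
  rw [this, Finset.prod, Multiset.toFinset_val, Multiset.dedup_eq_self.2 hnodup]

/-- Gauss quadrature. -/
theorem exists_gauss_quadrature
    (hpos : ∀ p : ℝ[X], p ≠ 0 → p.degree < k → 0 < Λ (p * p)) :
    ∃ α ρ : Fin k → ℝ, StrictMono α ∧
      ∀ f : ℝ[X], f.degree < (2 * k : ℕ) → Λ f = ∑ i, ρ i * f.eval (α i) := by
  obtain ⟨P, hP, hd, horth⟩ := exists_monic_orthogonal hpos
  obtain ⟨α, hα, hprod⟩ := exists_eq_prod_of_orthogonal hpos hP hd horth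
  refine ⟨α, fun i => Λ (Lagrange.basis univ α i), hα, fun f hf => ?_⟩
  have hinj : Set.InjOn α (univ : Finset (Fin k)) := hα.injective.injOn
  have hdvd := modByMonic_add_div f P
  -- Both quotient and remainder have degree below `k`: the quotient part is killed by
  -- orthogonality, and the remainder is its own Lagrange interpolant at the zeros of `P`.
  have hmod : (f %ₘ P).degree < k := hd ▸ degree_modByMonic_lt f hP
  have hquot : (f /ₘ P).degree < k := by
    by_cases h0 : f /ₘ P = 0
    · rw [h0, degree_zero]; exact WithBot.bot_lt_coe k
    · rw [degree_eq_natDegree h0, natDegree_divByMonic f hP, natDegree_eq_of_degree_eq_some hd]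
      have hf0 : f ≠ 0 := by rintro rfl; simp at h0
      have h1 : ¬ f.natDegree < P.natDegree := fun h =>
        h0 ((divByMonic_eq_zero_iff hP).2 (degree_lt_degree h))
      rw [natDegree_eq_of_degree_eq_some hd] at h1
      rw [degree_eq_natDegree hf0] at hf
      norm_cast at hf ⊢
      omega
  have heval : ∀ i, f.eval (α i) = (f %ₘ P).eval (α i) := fun i => by
    have hroot : P.eval (α i) = 0 := by
      rw [hprod, eval_prod]
      exact prod_eq_zero (mem_univ i) (by simp)
    conv_lhs => rw [← hdvd]
    simp [hroot]
  have hint : f %ₘ P = ∑ i, C ((f %ₘ P).eval (α i)) * Lagrange.basis univ α i := by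
    have := Lagrange.eq_interpolate (f := f %ₘ P) hinj (by simpa using hmod)
    rwa [Lagrange.interpolate_apply] at this
  conv_lhs => rw [← hdvd, map_add, horth _ hquot, add_zero, hint, map_sum]
  refine sum_congr rfl fun i _ => ?_
  rw [heval, ← smul_eq_C_mul, map_smul, smul_eq_mul, mul_comm]

/-- The squared Lagrange basis polynomial is the indicator of node `i` on the nodes, hence a test
function isolating one weight. -/
lemma sum_mul_eval_mul_basis_sq {α ρ : Fin k → ℝ} (hα : Function.Injective α) (g : ℝ[X])
    (i : Fin k) :
    ∑ j, ρ j * (g * (Lagrange.basis univ α i * Lagrange.basis univ α i)).eval (α j)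
      = ρ i * g.eval (α i) := by
  rw [sum_eq_single i]
  · simp [Lagrange.eval_basis_self hα.injOn (mem_univ i)]
  · intro j _ hj
    simp [Lagrange.eval_basis_of_ne hj.symm (mem_univ j)]
  · simp

/-- If `g` has degree at most one and `Λ (g p²) > 0` for all nonzero `p` of degree less than `k`,
then a quadrature formula of degree `2k-1` has `ρ i * g (α i) > 0` for all `i`. -/
lemma weight_mul_eval_pos {α ρ : Fin k → ℝ} (hα : StrictMono α)
    (hquad : ∀ f : ℝ[X], f.degree < (2 * k : ℕ) → Λ f = ∑ i, ρ i * f.eval (α i))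
    {g : ℝ[X]} (hg : g.degree ≤ 1)
    (hpos : ∀ p : ℝ[X], p ≠ 0 → p.degree < k → 0 < Λ (g * (p * p))) (i : Fin k) :
    0 < ρ i * g.eval (α i) := by
  have hb := Lagrange.degree_basis (s := univ) hα.injective.injOn (mem_univ i)
  have hi := i.2
  rw [card_univ, Fintype.card_fin] at hb
  have h := hpos _ (Lagrange.basis_ne_zero hα.injective.injOn (mem_univ i))
    (by rw [hb]; norm_cast; omega)
  rwa [hquad, sum_mul_eval_mul_basis_sq hα.injective] at h
  refine lt_of_le_of_lt (degree_mul_le _ _) ?_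
  refine lt_of_le_of_lt (add_le_add_left hg _) ?_
  rw [degree_mul, hb]
  norm_cast
  omega

/-- A quadrature formula with `k` nodes and degree `2k-1` is unique. -/
lemma gauss_quadrature_unique
    (hpos : ∀ p : ℝ[X], p ≠ 0 → p.degree < k → 0 < Λ (p * p))
    {α ρ α' ρ' : Fin k → ℝ} (hα : StrictMono α) (hα' : StrictMono α')
    (hquad : ∀ f : ℝ[X], f.degree < (2 * k : ℕ) → Λ f = ∑ i, ρ i * f.eval (α i))
    (hquad' : ∀ f : ℝ[X], f.degree < (2 * k : ℕ) → Λ f = ∑ i, ρ' i * f.eval (α' i)) :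
    α = α' ∧ ρ = ρ' := by
  have horth : ∀ {α ρ : Fin k → ℝ},
      (∀ f : ℝ[X], f.degree < (2 * k : ℕ) → Λ f = ∑ i, ρ i * f.eval (α i)) →
      ∀ g : ℝ[X], g.degree < k → Λ (Lagrange.nodal univ α * g) = 0 := by
    intro α ρ hquad g hg
    rw [hquad]
    · exact sum_eq_zero fun i _ => by simp [Lagrange.eval_nodal_at_node (mem_univ i)]
    · rcases eq_or_ne g 0 with rfl | hg0
      · simp only [mul_zero, degree_zero]; exact WithBot.bot_lt_coe _
      · rw [degree_mul, Lagrange.degree_nodal, card_univ, Fintype.card_fin]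
        rw [degree_eq_natDegree hg0] at hg ⊢
        norm_cast at hg ⊢
        omega
  have hnodal : Lagrange.nodal univ α = Lagrange.nodal univ α' := by
    -- Two monic nodal polynomials of degree `k` differ by something of lower degree that is
    -- orthogonal to itself.
    by_contra hne
    have hdeg : (Lagrange.nodal univ α - Lagrange.nodal univ α').degree < k := by
      have := degree_sub_lt_left (p := Lagrange.nodal univ α) (q := Lagrange.nodal univ α')
        (by simp [Lagrange.degree_nodal]) Lagrange.nodal_ne_zero
        (by rw [Lagrange.nodal_monic.leadingCoeff, Lagrange.nodal_monic.leadingCoeff])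
      simpa [Lagrange.degree_nodal] using this
    have h := hpos _ (sub_ne_zero.2 hne) hdeg
    rw [sub_mul, map_sub, horth hquad _ hdeg, horth hquad' _ hdeg, sub_zero] at h
    exact lt_irrefl _ h
  have hrange : ∀ {α α' : Fin k → ℝ}, Lagrange.nodal univ α = Lagrange.nodal univ α' →
      Set.range α ⊆ Set.range α' := by
    rintro α α' h _ ⟨i, rfl⟩
    have h1 : (Lagrange.nodal univ α').eval (α i) = 0 := by
      rw [← h, Lagrange.eval_nodal_at_node (mem_univ i)]
    rw [Lagrange.eval_nodal, prod_eq_zero_iff] at h1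
    obtain ⟨j, _, hj⟩ := h1
    exact ⟨j, (sub_eq_zero.1 hj).symm⟩
  have hαα' : α = α' :=
    (hα.range_inj hα').1 ((hrange hnodal).antisymm (hrange hnodal.symm))
  subst hαα'
  refine ⟨rfl, funext fun i => ?_⟩
  have hb := Lagrange.degree_basis (s := univ) hα.injective.injOn (mem_univ i)
  have hi := i.2
  rw [card_univ, Fintype.card_fin] at hb
  have hdeg : (1 * (Lagrange.basis univ α i * Lagrange.basis univ α i)).degree < (2 * k : ℕ) := by
    rw [one_mul, degree_mul, hb]
    norm_cast
    omega
  have h := hquad _ hdeg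
  rw [hquad' _ hdeg, sum_mul_eval_mul_basis_sq hα.injective,
    sum_mul_eval_mul_basis_sq hα.injective] at h
  simpa using h.symm

end GaussQuadrature

/-! ### Interpolation of absolutely monotone functions from below. -/

section HermiteInterpolation

/-- `F 0` is smooth on `(-1,1)` with the nonnegative derivatives `F 1, F 2, …`, and `F 0 ≥ 0`. -/
def IsNonnegJet (F : ℕ → ℝ → ℝ) : Prop :=
  ∀ m, ∀ t ∈ Set.Ioo (-1 : ℝ) 1, HasDerivAt (F m) (F (m + 1) t) t ∧ 0 ≤ F m t

lemma IsNonnegJet.monotoneOn {F : ℕ → ℝ → ℝ} (hF : IsNonnegJet F) (m : ℕ) :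
    MonotoneOn (F m) (Set.Ioo (-1) 1) := by
  refine monotoneOn_of_hasDerivWithinAt_nonneg (f' := F (m + 1)) (convex_Ioo _ _)
    (fun t ht => (hF m t ht).1.continuousAt.continuousWithinAt) (fun t ht => ?_) (fun t ht => ?_)
  · rw [interior_Ioo] at ht
    exact (hF m t ht).1.hasDerivWithinAt
  · rw [interior_Ioo] at ht
    exact (hF (m + 1) t ht).2

lemma segment_mem_Ioo {a t s : ℝ} (ha : a ∈ Set.Ico (-1 : ℝ) 1) (ht : t ∈ Set.Ioo (-1 : ℝ) 1)
    (hs : s ∈ Set.Ioc (0 : ℝ) 1) : a + s * (t - a) ∈ Set.Ioo (-1 : ℝ) 1 := by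
  obtain ⟨h1, h2⟩ := ha
  obtain ⟨h3, h4⟩ := ht
  obtain ⟨h5, h6⟩ := hs
  constructor
  · nlinarith [mul_pos h5 (sub_pos.2 h3), mul_nonneg (sub_nonneg.2 h6) (sub_nonneg.2 h1)]
  · nlinarith [mul_pos h5 (sub_pos.2 h4), mul_nonneg (sub_nonneg.2 h6) (sub_nonneg.2 h2.le)]

/-- The divided difference of a function with nonnegative derivatives has nonnegative
derivatives. -/
lemma IsNonnegJet.exists_divided_difference {F : ℕ → ℝ → ℝ} (hF : IsNonnegJet F) {a : ℝ}
    (ha : a ∈ Set.Ico (-1 : ℝ) 1)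
    (hcont : ∀ m, ContinuousOn (F m) (insert a (Set.Ioo (-1 : ℝ) 1))) :
    ∃ G, IsNonnegJet G ∧ ∀ t ∈ Set.Ioo (-1 : ℝ) 1, F 0 t = F 0 a + (t - a) * G 0 t := by
  have hsub : ∀ t ∈ Set.Ioo (-1 : ℝ) 1, ∀ m,
      ContinuousOn (fun s : ℝ => F m (a + s * (t - a))) (Set.Icc 0 1) := by
    intro t ht m
    refine (hcont m).comp (by fun_prop) fun s hs => ?_
    rcases hs.1.eq_or_lt with h0 | h0
    · left; simp [← h0]
    · right; exact segment_mem_Ioo ha ht ⟨h0, hs.2⟩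
  have hcont' : ∀ t ∈ Set.Ioo (-1 : ℝ) 1, ∀ m j : ℕ,
      ContinuousOn (fun s : ℝ => s ^ j * F m (a + s * (t - a))) (Set.Icc 0 1) :=
    fun t ht m j => ContinuousOn.mul (by fun_prop) (hsub t ht m)
  have hint : ∀ t ∈ Set.Ioo (-1 : ℝ) 1, ∀ m j : ℕ,
      IntervalIntegrable (fun s : ℝ => s ^ j * F m (a + s * (t - a))) MeasureTheory.volume 0 1 :=
    fun t ht m j => ContinuousOn.intervalIntegrable
      (by rw [Set.uIcc_of_le zero_le_one]; exact hcont' t ht m j)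
  have hu : Set.uIoc (0 : ℝ) 1 = Set.Ioc 0 1 := Set.uIoc_of_le zero_le_one
  -- Hadamard's formula `(F(t) - F(a))/(t - a) = ∫₀¹ F'(a + s(t-a)) ds`, differentiated `m` times
  -- under the integral.
  refine ⟨fun m t => ∫ s in (0 : ℝ)..1, s ^ m * F (m + 1) (a + s * (t - a)),
    fun m t ht => ⟨?_, ?_⟩, fun t ht => ?_⟩
  -- For `x` in `(-1,b)` the segment from `a` to `x` stays below `c = max a b < 1`, so monotonicity
  -- gives the constant dominating function `F (m+2) c`.
  · set b := (t + 1) / 2 with hb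
    have htb : t < b := by rw [hb]; linarith [ht.2]
    have hb1 : b < 1 := by rw [hb]; linarith [ht.2]
    set c := max a b with hc
    have hc1 : c ∈ Set.Ioo (-1 : ℝ) 1 :=
      ⟨lt_of_lt_of_le (ht.1.trans htb) (le_max_right _ _), max_lt ha.2 hb1⟩
    have hIoo : ∀ x ∈ Set.Ioo (-1 : ℝ) b, x ∈ Set.Ioo (-1 : ℝ) 1 :=
      fun x hx => ⟨hx.1, hx.2.trans hb1⟩
    have hnhds : Set.Ioo (-1) b ∈ nhds t := Ioo_mem_nhds ht.1 htb
    refine (intervalIntegral.hasDerivAt_integral_of_dominated_loc_of_deriv_le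
      (F' := fun x s => s ^ (m + 1) * F (m + 1 + 1) (a + s * (x - a)))
      (bound := fun _ => F (m + 1 + 1) c) hnhds ?_ (hint t ht _ _)
      (by rw [hu]; exact (((intervalIntegrable_iff_integrableOn_Ioc_of_le zero_le_one).1
        (hint t ht _ _)).aestronglyMeasurable)) ?_ (by simp) ?_).2
    · filter_upwards [hnhds] with x hx
      rw [hu]
      exact ((intervalIntegrable_iff_integrableOn_Ioc_of_le zero_le_one).1
        (hint x (hIoo x hx) _ _)).aestronglyMeasurable
    · refine Filter.Eventually.of_forall fun s hs x hx => ?_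
      rw [hu] at hs
      have hp := segment_mem_Ioo ha (hIoo x hx) hs
      have h0 := (hF (m + 1 + 1) _ hp).2
      have hle : a + s * (x - a) ≤ c := by
        have h1 : a ≤ c := le_max_left _ _
        have h2 : x ≤ c := hx.2.le.trans (le_max_right _ _)
        nlinarith [mul_nonneg hs.1.le (sub_nonneg.2 h2),
          mul_nonneg (sub_nonneg.2 hs.2) (sub_nonneg.2 h1)]
      rw [Real.norm_eq_abs, abs_of_nonneg (mul_nonneg (pow_nonneg hs.1.le _) h0)]
      exact (mul_le_of_le_one_left h0 (pow_le_one₀ hs.1.le hs.2)).trans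
        (hF.monotoneOn _ hp hc1 hle)
    · refine Filter.Eventually.of_forall fun s hs x hx => ?_
      rw [hu] at hs
      have hp := segment_mem_Ioo ha (hIoo x hx) hs
      have hlin : HasDerivAt (fun x => a + s * (x - a)) s x := by
        simpa using (((hasDerivAt_id x).sub_const a).const_mul s).const_add a
      have h1 := ((hF (m + 1) _ hp).1.comp x hlin).const_mul (s ^ m)
      convert! h1 using 1
      ring
  · refine intervalIntegral.integral_nonneg_of_ae_restrict zero_le_one ?_
    -- The endpoint `s = 0` is discarded: there the argument is `a`, which may be `-1`, where no
    -- sign is assumed.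
    rw [MeasureTheory.Measure.restrict_congr_set MeasureTheory.Ioc_ae_eq_Icc.symm]
    filter_upwards [MeasureTheory.ae_restrict_mem measurableSet_Ioc] with s hs
    exact mul_nonneg (pow_nonneg hs.1.le _) (hF _ _ (segment_mem_Ioo ha ht hs)).2
  · have hftc := intervalIntegral.integral_eq_sub_of_hasDerivAt_of_le
      (f := fun s => F 0 (a + s * (t - a)))
      (f' := fun s => (t - a) * (s ^ 0 * F (0 + 1) (a + s * (t - a)))) zero_le_one (hsub t ht 0)
      (fun s hs => by
        have hlin : HasDerivAt (fun s => a + s * (t - a)) (t - a) s := by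
          simpa using ((hasDerivAt_id s).mul_const (t - a)).const_add a
        have h1 := (hF 0 _ (segment_mem_Ioo ha ht ⟨hs.1, hs.2.le⟩)).1.comp s hlin
        convert! h1 using 1
        ring) ((hint t ht _ _).const_mul _)
    rw [intervalIntegral.integral_const_mul] at hftc
    rw [hftc]
    simp

/-- Newton interpolation with nonnegative remainder. -/
lemma IsNonnegJet.exists_interpolation (l : List ℝ) (hl : ∀ a ∈ l, a ∈ Set.Ioo (-1 : ℝ) 1) :
    ∀ F : ℕ → ℝ → ℝ, IsNonnegJet F → ∃ f : ℝ[X], f.degree < (l.length : ℕ) ∧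
      ∃ r : ℝ → ℝ, ∀ t ∈ Set.Ioo (-1 : ℝ) 1,
        0 ≤ r t ∧ F 0 t = f.eval t + (l.map fun a => t - a).prod * r t := by
  induction l with
  | nil =>
    intro F hF
    exact ⟨0, by simp, F 0, fun t ht => ⟨(hF 0 t ht).2, by simp⟩⟩
  | cons a l ih =>
    intro F hF
    have ha := hl a (by simp)
    obtain ⟨G, hG, hFG⟩ := hF.exists_divided_difference ⟨ha.1.le, ha.2⟩ fun m => by
      rw [Set.insert_eq_of_mem ha]
      exact fun t ht => (hF m t ht).1.continuousAt.continuousWithinAt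
    obtain ⟨f, hf, r, hr⟩ := ih (fun b hb => hl b (by simp [hb])) G hG
    refine ⟨C (F 0 a) + (X - C a) * f, ?_, r, fun t ht => ⟨(hr t ht).1, ?_⟩⟩
    · have hC : (C (F 0 a)).degree < ((a :: l).length : ℕ) :=
        lt_of_le_of_lt degree_C_le (by norm_cast; simp)
      refine lt_of_le_of_lt (degree_add_le _ _) (max_lt hC ?_)
      rcases eq_or_ne f 0 with rfl | hf0
      · simp only [mul_zero, degree_zero]; exact WithBot.bot_lt_coe _
      · rw [degree_mul, degree_X_sub_C, List.length_cons]
        rw [degree_eq_natDegree hf0] at hf ⊢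
        norm_cast at hf ⊢
        omega
    · rw [hFG t ht, (hr t ht).2]
      simp
      ring

/-- At interior points the derivative within `[-1,1)` is the ordinary one. Working within the
half-open interval keeps one-sided derivatives at `-1`, needed for a divided difference there. -/
lemma isNonnegJet_iteratedDerivWithin {h : ℝ → ℝ}
    (hh : AbsolutelyMonotoneOn h (Set.Ico (-1) 1)) :
    IsNonnegJet fun m => iteratedDerivWithin m h (Set.Ico (-1) 1) := by
  intro m t ht
  have ht' : t ∈ Set.Ico (-1 : ℝ) 1 := ⟨ht.1.le, ht.2⟩
  have hs := uniqueDiffOn_Ico (-1 : ℝ) 1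
  refine ⟨?_, hh.iteratedDerivWithin_nonneg hs m ht'⟩
  have h1 := (hh.contDiffOn.differentiableOn_iteratedDerivWithin (m := m)
    (by exact_mod_cast WithTop.coe_lt_top _) hs t ht').hasDerivWithinAt
  rw [← iteratedDerivWithin_succ] at h1
  exact h1.hasDerivAt (Ico_mem_nhds ht.1 ht.2)

lemma le_on_Ico_of_le_on_Ioo {h : ℝ → ℝ} (hh : ContinuousOn h (Set.Ico (-1) 1)) {f : ℝ[X]}
    (hf : ∀ t ∈ Set.Ioo (-1 : ℝ) 1, f.eval t ≤ h t) :
    ∀ t ∈ Set.Ico (-1 : ℝ) 1, f.eval t ≤ h t := by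
  intro t ht
  have hcl : t ∈ closure (Set.Ioo (-1 : ℝ) 1) := by
    rw [closure_Ioo (by norm_num)]; exact ⟨ht.1, ht.2.le⟩
  exact ContinuousWithinAt.closure_le hcl f.continuous.continuousWithinAt
    ((hh t ht).mono Set.Ioo_subset_Ico_self) hf

/-- Hermite interpolation from below of an absolutely monotone function, with double nodes. -/
theorem exists_le_of_double_nodes {h : ℝ → ℝ} (hh : AbsolutelyMonotoneOn h (Set.Ico (-1) 1))
    {k : ℕ} (α : Fin k → ℝ) (hα : ∀ i, α i ∈ Set.Ioo (-1 : ℝ) 1) :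
    ∃ f : ℝ[X], f.degree < (2 * k : ℕ) ∧ (∀ t ∈ Set.Ico (-1 : ℝ) 1, f.eval t ≤ h t) ∧
      ∀ i, f.eval (α i) = h (α i) := by
  -- Listing every node twice makes the product in the remainder a square.
  obtain ⟨f, hf, r, hr⟩ := IsNonnegJet.exists_interpolation (List.ofFn α ++ List.ofFn α)
    (by simpa using hα) _ (isNonnegJet_iteratedDerivWithin hh)
  simp only [iteratedDerivWithin_zero, List.map_append, List.prod_append] at hr
  refine ⟨f, by simpa [two_mul] using hf, le_on_Ico_of_le_on_Ioo hh.contDiffOn.continuousOn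
    fun t ht => ?_, fun i => ?_⟩
  · rw [(hr t ht).2]
    exact le_add_of_nonneg_right (mul_nonneg (mul_self_nonneg _) (hr t ht).1)
  · rw [(hr _ (hα i)).2, List.prod_eq_zero (l := List.map _ _)]
    · simp
    · simp [sub_eq_zero]

/-- Hermite interpolation from below of an absolutely monotone function, with the simple node `-1`
and double nodes otherwise. -/
theorem exists_le_of_neg_one_of_double_nodes {h : ℝ → ℝ}
    (hh : AbsolutelyMonotoneOn h (Set.Ico (-1) 1))
    {k : ℕ} (β : Fin k → ℝ) (hβ : ∀ i, β i ∈ Set.Ioo (-1 : ℝ) 1) :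
    ∃ f : ℝ[X], f.degree < (2 * k + 1 : ℕ) ∧ (∀ t ∈ Set.Ico (-1 : ℝ) 1, f.eval t ≤ h t) ∧
      f.eval (-1) = h (-1) ∧ ∀ i, f.eval (β i) = h (β i) := by
  -- Splitting off the simple node `-1` costs only the factor `t + 1`, nonnegative on the interval;
  -- the double nodes then interpolate the divided difference `G`.
  obtain ⟨G, hG, hhG⟩ := (isNonnegJet_iteratedDerivWithin hh).exists_divided_difference
    (a := -1) (by norm_num) fun m => by
      rw [Set.Ioo_insert_left (by norm_num)]
      exact hh.contDiffOn.continuousOn_iteratedDerivWithin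
        (by exact_mod_cast le_top) (uniqueDiffOn_Ico _ _)
  obtain ⟨f, hf, r, hr⟩ := IsNonnegJet.exists_interpolation (List.ofFn β ++ List.ofFn β)
    (by simpa using hβ) G hG
  simp only [iteratedDerivWithin_zero, List.map_append, List.prod_append] at hr hhG
  have hf2 : f.degree < (2 * k : ℕ) := by simpa [two_mul] using hf
  refine ⟨C (h (-1)) + (X - C (-1)) * f, ?_,
    le_on_Ico_of_le_on_Ioo hh.contDiffOn.continuousOn fun t ht => ?_, by simp, fun i => ?_⟩
  · have hC : (C (h (-1))).degree < (2 * k + 1 : ℕ) :=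
      lt_of_le_of_lt degree_C_le (by norm_cast; simp)
    refine lt_of_le_of_lt (degree_add_le _ _) (max_lt hC ?_)
    rcases eq_or_ne f 0 with rfl | hf0
    · simp only [mul_zero, degree_zero]; exact WithBot.bot_lt_coe _
    · rw [degree_mul, degree_X_sub_C]
      rw [degree_eq_natDegree hf0] at hf2 ⊢
      norm_cast at hf2 ⊢
      omega
  · rw [hhG t ht, (hr t ht).2]
    simp only [eval_add, eval_C, eval_mul, eval_sub, eval_X]
    have h1 : 0 ≤ t - -1 := by linarith [ht.1]
    have h2 := mul_nonneg h1 (mul_nonneg (mul_self_nonneg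
      (List.map (fun a => t - a) (List.ofFn β)).prod) (hr t ht).1)
    linarith
  · rw [hhG _ (hβ i), (hr _ (hβ i)).2, List.prod_eq_zero (l := List.map _ _)]
    · simp
    · simp [sub_eq_zero]

end HermiteInterpolation

/-! ### Binomial moments, Krawtchouk orthogonality and the Christoffel function at zero. -/

section BinomialMean

/-- A linear functional is determined on the polynomials of degree less than `m` by its values on
monic polynomials of the degrees less than `m`. -/
lemma linearMap_eq_of_monic {V : Type*} [AddCommGroup V] [Module ℝ V] {Φ Ψ : ℝ[X] →ₗ[ℝ] V}
    {p : ℕ → ℝ[X]} (hp : ∀ j, (p j).Monic) (hdeg : ∀ j, (p j).natDegree = j) (m : ℕ)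
    (h : ∀ j < m, Φ (p j) = Ψ (p j)) {f : ℝ[X]} (hf : f.degree < m) : Φ f = Ψ f := by
  induction m generalizing f with
  | zero =>
    have : f = 0 := by
      rw [← degree_eq_bot]
      exact Nat.WithBot.lt_zero_iff.1 (by simpa using hf)
    simp [this]
  | succ m ih =>
    -- Subtracting the multiple of the monic `p m` removes the top coefficient.
    have h1 : (f - C (f.coeff m) * p m).degree < m := by
      rw [degree_lt_iff_coeff_zero]
      intro i hi
      rw [coeff_sub, coeff_C_mul]
      rcases hi.eq_or_lt with rfl | hlt
      · have : (p m).coeff m = 1 := by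
          have := (hp m).coeff_natDegree
          rwa [hdeg m] at this
        rw [this, mul_one, sub_self]
      · rw [(degree_lt_iff_coeff_zero f (m + 1)).1 hf i hlt,
          coeff_eq_zero_of_natDegree_lt (p := p m) (by rw [hdeg]; exact hlt)]
        simp
    have h2 := ih (fun j hj => h j (by omega)) h1
    rw [map_sub, map_sub, ← smul_eq_C_mul, map_smul, map_smul, h m (by omega)] at h2
    exact sub_left_injective h2

/-- The expectation of `f(z)` for a binomial variable `z` with `N` trials and success probability
`(q-1)/q`. -/
def binomialMean (N q : ℕ) : ℝ[X] →ₗ[ℝ] ℝ :=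
  ((q : ℝ) ^ N)⁻¹ • ∑ z ∈ range (N + 1), ((N.choose z : ℝ) * ((q : ℝ) - 1) ^ z) • leval (z : ℝ)

lemma binomialMean_apply (N q : ℕ) (f : ℝ[X]) :
    binomialMean N q f = ((q : ℝ) ^ N)⁻¹ *
      ∑ z ∈ range (N + 1), (N.choose z : ℝ) * ((q : ℝ) - 1) ^ z * f.eval (z : ℝ) := by
  simp [binomialMean, leval]

lemma binomialMean_nonneg {N q : ℕ} (hq : 2 ≤ q) {f : ℝ[X]}
    (hf : ∀ z ≤ N, 0 ≤ f.eval (z : ℝ)) : 0 ≤ binomialMean N q f := by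
  have hq1 : (0 : ℝ) < (q : ℝ) - 1 := by
    have : (2 : ℝ) ≤ q := by exact_mod_cast hq
    linarith
  rw [binomialMean_apply]
  refine mul_nonneg (by positivity) (sum_nonneg fun z hz => ?_)
  have := hf z (by simpa [Nat.lt_succ_iff] using hz)
  positivity

lemma binomialMean_pos {N q : ℕ} (hq : 2 ≤ q) {f : ℝ[X]}
    (hf : ∀ z ≤ N, 0 ≤ f.eval (z : ℝ)) (hex : ∃ z ≤ N, 0 < f.eval (z : ℝ)) :
    0 < binomialMean N q f := by
  have hq1 : (0 : ℝ) < (q : ℝ) - 1 := by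
    have : (2 : ℝ) ≤ q := by exact_mod_cast hq
    linarith
  have hq0 : 0 < q := by omega
  rw [binomialMean_apply]
  obtain ⟨w, hw, hw0⟩ := hex
  refine mul_pos (by positivity) (sum_pos' (fun z hz => ?_) ⟨w, by simpa [Nat.lt_succ_iff], ?_⟩)
  · have := hf z (by simpa [Nat.lt_succ_iff] using hz)
    positivity
  · have := Nat.choose_pos hw
    positivity

/-- A nonzero polynomial of degree less than `b - a` does not vanish at all of `v a, …, v (b-1)`. -/
lemma exists_eval_ne_zero {p : ℝ[X]} (hp : p ≠ 0) {v : ℕ → ℝ} (hv : Function.Injective v) {a b : ℕ}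
    (hd : p.degree < (b - a : ℕ)) : ∃ z : ℕ, a ≤ z ∧ z < b ∧ p.eval (v z) ≠ 0 := by
  by_contra! h
  refine hp (eq_zero_of_degree_lt_of_eval_index_eq_zero (s := Ico a b) (v := v)
    hv.injOn (by simpa using hd) fun z hz => ?_)
  rw [mem_Ico] at hz
  exact h z hz.1 hz.2

lemma exists_krawtchoukPoly (n q i : ℕ) :
    ∃ P : ℝ[X], P.natDegree ≤ i ∧ ∀ z : ℝ, P.eval z = krawtchouk n q i z := by
  have hch : ∀ (j : ℕ) (z : ℝ), Ring.choose z j = ((j.factorial : ℝ))⁻¹ *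
      (descPochhammer ℝ j).eval z := by
    intro j z
    rw [Ring.choose_eq_smul, descPochhammer_smeval_eq_ascPochhammer, ascPochhammer_smeval_eq_eval,
      descPochhammer_eval_eq_ascPochhammer, smul_eq_mul]
  refine ⟨∑ j ∈ range (i + 1), C ((-1) ^ j * ((q : ℝ) - 1) ^ (i - j) * (j.factorial : ℝ)⁻¹ *
    ((i - j).factorial : ℝ)⁻¹) * (descPochhammer ℝ j *
      (descPochhammer ℝ (i - j)).comp (C (n : ℝ) - X)), ?_, fun z => ?_⟩
  · refine natDegree_sum_le_of_forall_le _ _ fun j hj => ?_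
    rw [mem_range] at hj
    refine (natDegree_C_mul_le _ _).trans (natDegree_mul_le.trans ?_)
    rw [natDegree_comp, descPochhammer_natDegree, descPochhammer_natDegree]
    have : (C (n : ℝ) - X).natDegree ≤ 1 := by compute_degree
    nlinarith [Nat.sub_add_cancel (Nat.lt_succ_iff.1 hj)]
  · rw [eval_finsetSum, krawtchouk]
    refine sum_congr rfl fun j _ => ?_
    rw [hch, hch]
    simp only [eval_mul, eval_C, eval_comp, eval_sub, eval_X]
    ring

/-- The identity `C(n,z) C(z,j) = C(n,j) C(n-j,z-j)` reduces the sum to the binomial theorem. Over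
`ℝ[X]` it serves as a generating function for Krawtchouk sums, over `ℝ` it computes factorial
moments. -/
lemma sum_choose_mul_choose_mul_pow {R : Type*} [CommRing R] (n j : ℕ) (A B : R) :
    ∑ z ∈ range (n + 1), (n.choose z : R) * (z.choose j : R) * (A ^ z * B ^ (n - z))
      = (n.choose j : R) * (A ^ j * (A + B) ^ (n - j)) := by
  rcases lt_or_ge n j with hj | hj
  · rw [Nat.choose_eq_zero_of_lt hj, Nat.cast_zero, zero_mul]
    refine sum_eq_zero fun z hz => ?_
    rw [mem_range] at hz
    rw [Nat.choose_eq_zero_of_lt (show z < j by omega)]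
    simp
  · obtain ⟨m, rfl⟩ := Nat.exists_eq_add_of_le hj
    rw [add_assoc, sum_range_add, sum_eq_zero, zero_add, Nat.add_sub_cancel_left, add_pow,
      mul_sum, mul_sum]
    · refine sum_congr rfl fun z hz => ?_
      have h1 := Nat.choose_mul (n := j + m) (k := j + z) (s := j)
        (by omega)
      rw [Nat.add_sub_cancel_left, Nat.add_sub_cancel_left] at h1
      rw [← Nat.cast_mul, h1, Nat.add_sub_add_left]
      push_cast
      ring
    · intro z hz
      rw [Nat.choose_eq_zero_of_lt (mem_range.1 hz)]
      simp

/-- The Krawtchouk polynomial `K_i` is orthogonal to the polynomials of degree less than `i`. -/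
lemma sum_mul_krawtchouk_eq_zero (n q i : ℕ) {f : ℝ[X]} (hf : f.degree < i) :
    ∑ z ∈ range (n + 1), (n.choose z : ℝ) * ((q : ℝ) - 1) ^ z * f.eval (z : ℝ)
      * krawtchouk n q i z = 0 := by
  have key : ∀ j < i, ∑ z ∈ range (n + 1), ((n.choose z : ℝ) * ((q : ℝ) - 1) ^ z
      * krawtchouk n q i z) • leval (z : ℝ) (descPochhammer ℝ j) = 0 := by
    intro j hj
    -- The two bases add up to the constant `q`, so the generating function of the `j`-th moments
    -- has degree at most `j` in `X`; its coefficient at `i > j` vanishes.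
    have h1 := sum_choose_mul_choose_mul_pow (R := ℝ[X]) n j
      (C ((q : ℝ) - 1) * (1 + C (-1) * X)) (1 + C ((q : ℝ) - 1) * X)
    have h2 : (C ((q : ℝ) - 1) * (1 + C (-1) * X)) + (1 + C ((q : ℝ) - 1) * X) = C (q : ℝ) := by
      simp only [C_sub, C_1, C_neg]; ring
    rw [h2] at h1
    have h3 : ((n.choose j : ℝ[X]) * ((C ((q : ℝ) - 1) * (1 + C (-1) * X)) ^ j
        * C (q : ℝ) ^ (n - j))).coeff i = 0 := by
      apply coeff_eq_zero_of_natDegree_lt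
      refine lt_of_le_of_lt ?_ hj
      have h4 : (C ((q : ℝ) - 1) * (1 + C (-1) * X) : ℝ[X]).natDegree ≤ 1 := by compute_degree
      rw [← C_eq_natCast, ← C_pow]
      refine (natDegree_C_mul_le _ _).trans ((natDegree_mul_C_le _ _).trans ?_)
      simpa using natDegree_pow_le_of_le j h4
    rw [← h1, finsetSum_coeff] at h3
    rw [← mul_zero (j.factorial : ℝ), ← h3, mul_sum]
    refine sum_congr rfl fun z hz => ?_
    rw [krawtchouk_natCast q i (by rw [mem_range] at hz; omega), mul_pow, ← C_pow,
      ← C_eq_natCast, ← C_eq_natCast, ← C_mul, mul_assoc (C _ : ℝ[X]), ← mul_assoc, ← C_mul,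
      coeff_C_mul, ← genPoly, leval_apply, descPochhammer_eval_eq_descFactorial,
      Nat.descFactorial_eq_factorial_mul_choose, smul_eq_mul]
    push_cast
    ring
  have h := linearMap_eq_of_monic (Φ := ∑ z ∈ range (n + 1), ((n.choose z : ℝ)
    * ((q : ℝ) - 1) ^ z * krawtchouk n q i z) • leval (z : ℝ)) (Ψ := 0)
    (p := fun j => descPochhammer ℝ j) (fun j => monic_descPochhammer ℝ j)
    (fun j => descPochhammer_natDegree ℝ j) i (fun j hj => by simpa using key j hj) hf
  rw [LinearMap.zero_apply, LinearMap.sum_apply] at h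
  rw [← h]
  refine sum_congr rfl fun z _ => ?_
  rw [LinearMap.smul_apply, leval_apply, smul_eq_mul]
  ring

/-- The reproducing property: `∑_{i ≤ m} K_i` represents the evaluation at `0`. -/
lemma binomialMean_kernel {n q m : ℕ} (hq : 2 ≤ q) (hm : m ≤ n) {G f : ℝ[X]}
    (hG : ∀ z : ℝ, G.eval z = ∑ i ∈ range (m + 1), krawtchouk n q i z)
    (hf : f.degree < (m + 1 : ℕ)) : binomialMean n q (G * f) = f.eval 0 := by
  have hq0 : (q : ℝ) ^ n ≠ 0 := by
    have : q ≠ 0 := by omega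
    positivity
  -- By orthogonality the kernel may be extended to all `i ≤ n`. The full sum of the `K_i(z)` is the
  -- generating polynomial at `1`, namely `q^n` at `z = 0` and zero at the other `z`.
  have h1 : ∑ i ∈ range (n + 1), ∑ z ∈ range (n + 1), (n.choose z : ℝ) * ((q : ℝ) - 1) ^ z
      * f.eval (z : ℝ) * krawtchouk n q i z
      = ∑ i ∈ range (m + 1), ∑ z ∈ range (n + 1), (n.choose z : ℝ) * ((q : ℝ) - 1) ^ z
      * f.eval (z : ℝ) * krawtchouk n q i z := by
    refine (sum_subset (range_mono (by omega)) fun i _ hi => ?_).symm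
    refine sum_mul_krawtchouk_eq_zero n q i (hf.trans_le ?_)
    rw [mem_range] at hi
    norm_cast
    omega
  rw [sum_comm, sum_comm (s := range (m + 1))] at h1
  simp only [← mul_sum] at h1
  have h2 : ∀ z ∈ range (n + 1), (n.choose z : ℝ) * ((q : ℝ) - 1) ^ z * (G * f).eval (z : ℝ)
      = (n.choose z : ℝ) * ((q : ℝ) - 1) ^ z * f.eval (z : ℝ)
        * ∑ i ∈ range (m + 1), krawtchouk n q i z := fun z _ => by
    rw [eval_mul, hG]; ring
  rw [binomialMean_apply, sum_congr rfl h2, ← h1, sum_eq_single_of_mem 0 (by simp)]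
  · have h3 := eval_genPoly q (Nat.zero_le n) 1
    simp only [one_pow, mul_one] at h3
    rw [← h3]
    simp only [genPoly, Nat.choose_zero_right, pow_zero, Nat.sub_zero, one_mul, eval_pow, eval_add,
      eval_one, eval_mul, eval_C, eval_X, mul_one, Nat.cast_one, Nat.cast_zero]
    rw [show (1 : ℝ) + (q - 1) = q by ring]
    field_simp
  · intro z hz hz0
    have h3 := eval_genPoly q (show z ≤ n by rw [mem_range] at hz; omega) 1
    simp only [one_pow, mul_one] at h3
    rw [← h3]
    simp [genPoly, hz0]

/-- The Christoffel function of the binomial distribution at `0`. -/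
theorem sq_eval_zero_le {n q m : ℕ} (hq : 2 ≤ q) (hm : m ≤ n) {f : ℝ[X]}
    (hf : f.degree < (m + 1 : ℕ)) :
    f.eval 0 ^ 2 ≤ (∑ i ∈ range (m + 1), n.choose i * (q - 1) ^ i : ℕ)
      * binomialMean n q (f * f) := by
  choose P hPd hP using exists_krawtchoukPoly n q
  set G := ∑ i ∈ range (m + 1), P i with hGdef
  have hG : ∀ z : ℝ, G.eval z = ∑ i ∈ range (m + 1), krawtchouk n q i z := fun z => by
    rw [hGdef, eval_finsetSum]; simp only [hP]
  have hGd : G.degree < (m + 1 : ℕ) := by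
    have : G.natDegree ≤ m := natDegree_sum_le_of_forall_le _ _ fun i hi =>
      (hPd i).trans (by rw [mem_range] at hi; omega)
    exact lt_of_le_of_lt (natDegree_le_iff_degree_le.1 this) (by norm_cast; omega)
  have hG0 : G.eval 0 = (∑ i ∈ range (m + 1), n.choose i * (q - 1) ^ i : ℕ) := by
    rw [hG]
    push_cast [Nat.cast_sub (show 1 ≤ q by omega)]
    refine sum_congr rfl fun i _ => ?_
    have := krawtchouk_natCast q i (Nat.zero_le n)
    rw [Nat.cast_zero] at this
    rw [this, genPoly, pow_zero, one_mul, coeff_one_add_C_mul_X_pow, Nat.sub_zero, mul_comm]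
  rw [← hG0]
  have hpos : 0 < G.eval 0 := by
    rw [hG0, Nat.cast_pos, sum_range_succ']
    simp
  have h1 := binomialMean_kernel hq hm hG hf
  have h2 := binomialMean_kernel hq hm hG hGd
  -- Cauchy–Schwarz for `f` and the kernel `G`, using that the means of `G f` and `G G` are `f(0)`
  -- and `G(0)`.
  have h3 : 0 ≤ binomialMean n q ((G.eval 0 • f - f.eval 0 • G) * (G.eval 0 • f - f.eval 0 • G)) :=
    binomialMean_nonneg hq fun z _ => by rw [eval_mul]; exact mul_self_nonneg _
  have h4 : (G.eval 0 • f - f.eval 0 • G) * (G.eval 0 • f - f.eval 0 • G)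
      = (G.eval 0 * G.eval 0) • (f * f) - (2 * G.eval 0 * f.eval 0) • (G * f)
        + (f.eval 0 * f.eval 0) • (G * G) := by
    simp only [smul_eq_C_mul, C_mul, map_ofNat]
    ring
  rw [h4, map_add, map_sub, map_smul, map_smul, map_smul, h1, h2] at h3
  simp only [smul_eq_mul] at h3
  have h5 : 0 ≤ G.eval 0 * (G.eval 0 * binomialMean n q (f * f) - f.eval 0 ^ 2) := by
    nlinarith
  linarith [nonneg_of_mul_nonneg_right h5 hpos]

end BinomialMean

/-! ### The coefficient `f_0` as a mean, and the linear programming bound for designs. -/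

section Designs

/-- The affine substitution `z ↦ 1 - 2 z / n`. -/
def distToIp (n : ℕ) : ℝ[X] := C 1 - C (2 / (n : ℝ)) * X

lemma eval_distToIp (n : ℕ) (z : ℝ) : (distToIp n).eval z = 1 - 2 * z / n := by
  simp [distToIp]; ring

/-- The binomial weight `C(n,z)(q-1)^z` equals `K_z(0)`, so orthogonality against column `0` leaves
only the term `i = 0`. -/
lemma krawtchoukCoeff_zero {n q : ℕ} (hn : 0 < n) (hq : 2 ≤ q) (f : ℝ[X]) :
    krawtchoukCoeff n q f 0 = binomialMean n q (f.comp (distToIp n)) := by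
  have hn' : (n : ℝ) ≠ 0 := by positivity
  have hq0 : (q : ℝ) ^ n ≠ 0 := by
    have : q ≠ 0 := by omega
    positivity
  have hc := (isKrawtchoukExpansion_iff hn hq f _).2 rfl
  set c := krawtchoukCoeff n q f
  have h1 : ∀ z ∈ range (n + 1), (n.choose z : ℝ) * ((q : ℝ) - 1) ^ z *
      (f.comp (distToIp n)).eval (z : ℝ) = ∑ i, c i / (((q : ℝ) - 1) ^ (i : ℕ) * n.choose i) *
        (krawtchouk n q i z * krawtchouk n q z (0 : ℕ)) := by
    intro z hz
    have hz : z ≤ n := by rw [mem_range] at hz; omega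
    have h2 := hc (1 - 2 * z / n) ⟨n - z, Nat.sub_le _ _, by
      rw [Nat.cast_sub hz]; field_simp; ring⟩
    rw [eval_comp, eval_distToIp, h2, mul_sum]
    refine sum_congr rfl fun i _ => ?_
    rw [normKrawtchouk, show (n : ℝ) * (1 - (1 - 2 * z / n)) / 2 = z by field_simp; ring,
      krawtchouk_natCast q z (Nat.zero_le n), genPoly, pow_zero, one_mul,
      coeff_one_add_C_mul_X_pow, Nat.sub_zero]
    ring
  rw [binomialMean_apply, sum_congr rfl h1, sum_comm]
  simp only [← mul_sum, sum_krawtchouk_mul hq _ (Nat.zero_le n)]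
  rw [sum_eq_single_of_mem (0 : Fin (n + 1)) (mem_univ _)]
  · simp
    field_simp
  · intro i _ hi
    have h0 : (i : ℕ) ≠ 0 := fun h => hi (Fin.ext h)
    rw [if_neg h0, mul_zero]

/-- In a `τ`-design, every choice of `j ≤ τ` coordinates contains every word equally often. -/
lemma IsDesign.card_filter_mul_pow {n q τ : ℕ} {C : Finset (HSpace n q)} (hC : IsDesign τ C)
    (hτ : τ ≤ n) {j : ℕ} (hj : j ≤ τ) : ∀ (S : Finset (Fin n)), #S = j → ∀ x : HSpace n q,
      #{y ∈ C | ∀ i ∈ S, y i = x i} * q ^ j = #C := by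
  obtain ⟨lam, -, hcard, hlam⟩ := hC
  induction hj using Nat.decreasingInduction with
  | self =>
    intro S hS x
    have h := hlam (S.orderEmbOfFin hS).toEmbedding fun j => x (S.orderEmbOfFin hS j)
    have heq : ∀ y : HSpace n q, (∀ i ∈ S, y i = x i) ↔
        ∀ j, y ((S.orderEmbOfFin hS).toEmbedding j) = x (S.orderEmbOfFin hS j) := by
      intro y
      refine ⟨fun h j => h _ (S.orderEmbOfFin_mem hS j), fun h i hi => ?_⟩
      have hr : i ∈ Set.range (S.orderEmbOfFin hS) := by simpa using hi
      obtain ⟨j, rfl⟩ := hr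
      exact h j
    simp only [heq]
    rw [h, hcard]
  | of_succ j hj ih =>
    intro S hS x
    -- Since `j < τ ≤ n`, a further coordinate is available; sorting codewords by their letter there
    -- gives `q` classes counted by the case `j + 1`.
    obtain ⟨i, hi⟩ : ∃ i, i ∉ S := by
      by_contra! h
      rw [eq_univ_iff_forall.2 h, card_univ, Fintype.card_fin] at hS
      omega
    have hT := ih (insert i S) (by rw [card_insert_of_notMem hi, hS])
    have hsum : #{y ∈ C | ∀ l ∈ S, y l = x l}
        = ∑ a : Fin q, #{y ∈ C | ∀ l ∈ insert i S, y l = Function.update x i a l} := by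
      rw [card_eq_sum_card_fiberwise (f := fun y => y i) (t := univ) (by simp)]
      refine sum_congr rfl fun a _ => congrArg card ?_
      ext y
      simp only [mem_filter, mem_insert, forall_eq_or_imp, Function.update_self]
      have : (∀ l ∈ S, y l = Function.update x i a l) ↔ ∀ l ∈ S, y l = x l :=
        forall₂_congr fun l hl => by
          rw [Function.update_of_ne (by rintro rfl; exact hi hl)]
      rw [this]
      tauto
    rcases Nat.eq_zero_or_pos q with rfl | hq
    · have := x i
      exact this.elim0
    · have h1 : ∀ a, #{y ∈ C | ∀ l ∈ insert i S, y l = Function.update x i a l} * q ^ (j + 1)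
          = #C := fun a => hT _
      have h2 : #{y ∈ C | ∀ l ∈ S, y l = x l} * q ^ (j + 1) = q * #C := by
        rw [hsum, sum_mul, sum_congr rfl fun a _ => h1 a]
        simp
      rw [pow_succ, ← mul_assoc, mul_comm q] at h2
      exact Nat.eq_of_mul_eq_mul_right hq h2

/-- For `τ > n` the column condition is vacuous; it is the size `lam * q ^ τ` that rules this case
out. -/
lemma IsDesign.le_length {n q τ : ℕ} (hq : 2 ≤ q) {C : Finset (HSpace n q)}
    (hC : IsDesign τ C) : τ ≤ n := by
  obtain ⟨lam, h0, hcard, -⟩ := hC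
  have h1 : #C ≤ q ^ n := by
    have := card_le_univ C
    simpa using this
  rw [hcard] at h1
  exact (Nat.pow_le_pow_iff_right (by omega)).1 ((Nat.le_mul_of_pos_left _ h0).trans h1)

lemma choose_eq_card_filter_subset {ι : Type*} [Fintype ι] [DecidableEq ι] (A : Finset ι) (j : ℕ) :
    (#A).choose j = #{S ∈ powersetCard j (univ : Finset ι) | S ⊆ A} := by
  rw [← card_powersetCard]
  congr 1
  ext S
  simp [mem_powersetCard, and_comm]

/-- Double counting of pairs of a codeword and a `j`-set of coordinates on which it agrees with `x`;
`n - d` is the number of agreements. -/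
lemma IsDesign.sum_choose {n q τ : ℕ} (hq : 2 ≤ q) {C : Finset (HSpace n q)} (hC : IsDesign τ C)
    {j : ℕ} (hj : j ≤ τ) (x : HSpace n q) :
    (∑ y ∈ C, (n - hammingDist x y).choose j) * q ^ j = n.choose j * #C := by
  have h1 : ∀ y, (n - hammingDist x y).choose j
      = ∑ S ∈ powersetCard j (univ : Finset (Fin n)), if ∀ i ∈ S, y i = x i then 1 else 0 := by
    intro y
    have h2 : n - hammingDist x y = #{i | y i = x i} := by
      have := card_filter_add_card_filter_not (s := (univ : Finset (Fin n)))
        (fun i => y i = x i)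
      rw [card_univ, Fintype.card_fin] at this
      rw [hammingDist_comm, hammingDist]
      simp only [ne_eq]
      omega
    rw [h2, choose_eq_card_filter_subset, card_filter]
    refine sum_congr rfl fun S _ => ?_
    simp [subset_iff]
  simp only [h1]
  rw [sum_comm, sum_mul]
  simp only [← card_filter]
  rw [sum_congr rfl fun S hS => hC.card_filter_mul_pow (hC.le_length hq) hj S
    (mem_powersetCard.1 hS).2 x]
  simp

/-- In a `τ`-design, the sum of a polynomial of degree at most `τ` in the inner products with a
fixed word. -/
theorem IsDesign.sum_eval_ip {n q τ : ℕ} (hn : 0 < n) (hq : 2 ≤ q) {C : Finset (HSpace n q)}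
    (hC : IsDesign τ C) {f : ℝ[X]} (hf : f.natDegree ≤ τ) (x : HSpace n q) :
    ∑ y ∈ C, f.eval (ip x y) = #C * krawtchoukCoeff n q f 0 := by
  have hn' : (n : ℝ) ≠ 0 := by positivity
  have hq0 : (q : ℝ) ≠ 0 := by
    have : q ≠ 0 := by omega
    positivity
  have hdist : ∀ y : HSpace n q, hammingDist x y ≤ n := fun y => by
    simpa using hammingDist_le_card_fintype (x := x) (y := y)
  -- The variable is changed to the number of agreements `w = n - z`, with `t = -1 + 2w/n`, since
  -- the design property gives the factorial moments of `w`.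
  let A : ℝ[X] := Polynomial.C (n : ℝ) - X
  let B : ℝ[X] := Polynomial.C (-1) + Polynomial.C (2 / (n : ℝ)) * X
  let Φ : ℝ[X] →ₗ[ℝ] ℝ := ∑ y ∈ C, leval ((n - hammingDist x y : ℕ) : ℝ)
  let Ψ : ℝ[X] →ₗ[ℝ] ℝ := (#C : ℝ) • binomialMean n q ∘ₗ (aeval A).toLinearMap
  have key : Φ (f.comp B) = Ψ (f.comp B) := by
    refine linearMap_eq_of_monic (p := fun j => descPochhammer ℝ j)
      (fun j => monic_descPochhammer ℝ j) (fun j => descPochhammer_natDegree ℝ j) (τ + 1)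
      (fun j hj => ?_) ?_
    · have h1 := hC.sum_choose hq (Nat.lt_succ_iff.1 hj) x
      have hjn : j ≤ n := (Nat.lt_succ_iff.1 hj).trans (hC.le_length hq)
      have h2 := sum_choose_mul_choose_mul_pow n j (1 : ℝ) ((q : ℝ) - 1)
      rw [← sum_flip] at h2
      have h3 : binomialMean n q ((descPochhammer ℝ j).comp A)
          = ((q : ℝ) ^ n)⁻¹ * (j.factorial * (n.choose j * (q : ℝ) ^ (n - j))) := by
        rw [binomialMean_apply]
        rw [one_pow, one_mul, show (1 : ℝ) + (q - 1) = q by ring] at h2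
        congr 1
        rw [← h2, mul_sum]
        refine sum_congr rfl fun z hz => ?_
        have hz : z ≤ n := by rw [mem_range] at hz; omega
        rw [eval_comp, show A.eval (z : ℝ) = ((n - z : ℕ) : ℝ) by simp [A, Nat.cast_sub hz],
          descPochhammer_eval_eq_descFactorial, Nat.descFactorial_eq_factorial_mul_choose,
          Nat.choose_symm hz, Nat.sub_sub_self hz]
        push_cast
        ring
      have h4 : Φ (descPochhammer ℝ j)
          = j.factorial * (∑ y ∈ C, (n - hammingDist x y).choose j : ℕ) := by
        simp only [Φ, LinearMap.sum_apply, leval_apply, descPochhammer_eval_eq_descFactorial,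
          Nat.descFactorial_eq_factorial_mul_choose]
        push_cast
        rw [mul_sum]
      have h5 : Ψ (descPochhammer ℝ j) = #C * binomialMean n q ((descPochhammer ℝ j).comp A) := by
        simp [Ψ, comp_eq_aeval]
      rw [h4, h5, h3]
      have h6 : ((∑ y ∈ C, (n - hammingDist x y).choose j : ℕ) : ℝ) * (q : ℝ) ^ j
          = n.choose j * #C := by exact_mod_cast h1
      have h7 : (q : ℝ) ^ n = q ^ j * q ^ (n - j) := by rw [← pow_add, Nat.add_sub_cancel' hjn]
      rw [h7]
      field_simp
      linarith
    · have hB : B.natDegree ≤ 1 := by simp only [B]; compute_degree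
      have h1 : (f.comp B).natDegree ≤ τ := natDegree_comp_le.trans (by nlinarith)
      exact lt_of_le_of_lt (natDegree_le_iff_degree_le.1 h1) (by norm_cast; omega)
  have h1 : Ψ (f.comp B) = #C * krawtchoukCoeff n q f 0 := by
    have hBA : B.comp A = distToIp n := by
      refine Polynomial.funext fun z => ?_
      simp only [eval_comp, eval_distToIp, A, B, eval_add, eval_mul, eval_sub, eval_C, eval_X]
      field_simp
      ring
    rw [krawtchoukCoeff_zero hn hq, ← hBA, ← comp_assoc]
    simp [Ψ, comp_eq_aeval]
  rw [← h1, ← key]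
  simp only [Φ, LinearMap.sum_apply, leval_apply]
  refine sum_congr rfl fun y _ => ?_
  rw [eval_comp, ip]
  congr 1
  simp only [B, eval_add, eval_mul, eval_C, eval_X, Nat.cast_sub (hdist y)]
  field_simp
  ring

/-- The linear programming bound for the energy of designs. -/
theorem IsDesign.le_energy {n q τ : ℕ} (hn : 0 < n) (hq : 2 ≤ q) {C : Finset (HSpace n q)}
    (hC : IsDesign τ C) {f : ℝ[X]} (hf : f.natDegree ≤ τ) {h : ℝ → ℝ}
    (hfh : ∀ t ∈ Set.Ico (-1 : ℝ) 1, f.eval t ≤ h t) :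
    krawtchoukCoeff n q f 0 * #C - f.eval 1 ≤ energy h C := by
  have hn' : (0 : ℝ) < n := by positivity
  have hpos : (0 : ℝ) < #C := by
    obtain ⟨lam, h0, hcard, -⟩ := hC
    have : 0 < q := by omega
    rw [Nat.cast_pos, hcard]
    positivity
  -- Each row sum of `f` over the whole code is `|C| f_0`; its diagonal term is `f(1)`, and `f ≤ h`
  -- bounds the rest.
  have hrow : ∀ x ∈ C, #C * krawtchoukCoeff n q f 0 - f.eval 1
      ≤ ∑ y ∈ C with x ≠ y, h (ip x y) := by
    intro x hx
    have h1 := hC.sum_eval_ip hn hq hf x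
    rw [← sum_filter_add_sum_filter_not C (fun y => x ≠ y)] at h1
    have h2 : ∑ y ∈ C with ¬ x ≠ y, f.eval (ip x y) = f.eval 1 := by
      rw [sum_eq_single_of_mem x (by simp [hx])]
      · simp [ip]
      · intro y hy hyx
        simp only [mem_filter, not_not] at hy
        exact absurd hy.2.symm hyx
    have h3 : ∑ y ∈ C with x ≠ y, f.eval (ip x y) ≤ ∑ y ∈ C with x ≠ y, h (ip x y) := by
      refine sum_le_sum fun y hy => hfh _ ?_
      have hxy : x ≠ y := (mem_filter.1 hy).2
      have hd0 : (0 : ℝ) < hammingDist x y := by exact_mod_cast hammingDist_pos.2 hxy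
      have hdn : (hammingDist x y : ℝ) ≤ n := by
        exact_mod_cast (by simpa using hammingDist_le_card_fintype (x := x) (y := y) :
          hammingDist x y ≤ n)
      rw [ip]
      constructor
      · have : 2 * (hammingDist x y : ℝ) / n ≤ 2 := by rw [div_le_iff₀ hn']; linarith
        linarith
      · have : 0 < 2 * (hammingDist x y : ℝ) / n := by positivity
        linarith
    linarith
  rw [energy, one_div, inv_mul_eq_div, le_div_iff₀ hpos]
  have := sum_le_sum hrow
  rw [sum_const, nsmul_eq_mul] at this
  linarith

end Designs

/-! ### Positivity of the functional `f_0 - f(1)/M` with polynomial weights. -/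

section Positivity

/-- The functional `f ↦ f_0 - f(1) / M`. -/
def quadratureFunctional (n q M : ℕ) : ℝ[X] →ₗ[ℝ] ℝ :=
  binomialMean n q ∘ₗ (aeval (distToIp n)).toLinearMap - (M : ℝ)⁻¹ • leval 1

lemma quadratureFunctional_apply (n q M : ℕ) (f : ℝ[X]) :
    quadratureFunctional n q M f = binomialMean n q (f.comp (distToIp n)) - f.eval 1 / M := by
  simp [quadratureFunctional, comp_eq_aeval, leval_apply, div_eq_inv_mul]

/-- A nonzero `p` of degree below `b - a` cannot vanish at all the lattice points where `g` is known
to be positive. -/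
lemma binomialMean_comp_distToIp_pos {n q : ℕ} (hn : 0 < n) (hq : 2 ≤ q) {g p : ℝ[X]}
    (hg : ∀ z : ℕ, z ≤ n → 0 ≤ g.eval (1 - 2 * (z : ℝ) / n)) {a b : ℕ} (hb : b ≤ n + 1)
    (hg' : ∀ z : ℕ, a ≤ z → z < b → 0 < g.eval (1 - 2 * (z : ℝ) / n))
    (hp : p ≠ 0) (hd : p.degree < (b - a : ℕ)) :
    0 < binomialMean n q ((g * (p * p)).comp (distToIp n)) := by
  have hn' : (n : ℝ) ≠ 0 := by positivity
  have hv : Function.Injective fun z : ℕ => 1 - 2 * (z : ℝ) / n := by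
    intro z w h
    have h' : 2 * (z : ℝ) / n = 2 * (w : ℝ) / n := by simpa using h
    field_simp at h'
    exact_mod_cast h'
  obtain ⟨z, haz, hzb, hz⟩ := exists_eval_ne_zero hp hv hd
  refine binomialMean_pos hq (fun w hw => ?_) ⟨z, by omega, ?_⟩
  · rw [eval_comp, eval_distToIp, eval_mul, eval_mul]
    exact mul_nonneg (hg w hw) (mul_self_nonneg _)
  · rw [eval_comp, eval_distToIp, eval_mul, eval_mul]
    exact mul_pos (hg' z haz hzb) (mul_self_pos.2 hz)

lemma degree_comp_distToIp_lt {m : ℕ} {p : ℝ[X]} (hd : p.degree < (m + 1 : ℕ)) (N : ℕ) :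
    (p.comp (distToIp N)).degree < (m + 1 : ℕ) := by
  have h1 : (distToIp N).natDegree ≤ 1 := by simp only [distToIp]; compute_degree
  have h2 : p.natDegree ≤ m := by
    rcases eq_or_ne p 0 with rfl | hp
    · simp
    · rw [degree_eq_natDegree hp] at hd
      norm_cast at hd
      omega
  have h3 : (p.comp (distToIp N)).natDegree ≤ m := natDegree_comp_le.trans (by nlinarith)
  exact lt_of_le_of_lt (natDegree_le_iff_degree_le.1 h3) (by norm_cast; omega)

/-- The Christoffel bound gives `p(1)² ≤ R · mean(p²)` with `R < M`; strictness needs the mean to be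
positive. -/
lemma quadratureFunctional_sq_pos {n q M m : ℕ} (hn : 0 < n) (hq : 2 ≤ q) (hm : m ≤ n)
    (hM : ∑ i ∈ range (m + 1), n.choose i * (q - 1) ^ i < M) {p : ℝ[X]} (hp : p ≠ 0)
    (hd : p.degree < (m + 1 : ℕ)) : 0 < quadratureFunctional n q M (p * p) := by
  have hM0 : (0 : ℝ) < M := by exact_mod_cast lt_of_le_of_lt (Nat.zero_le _) hM
  have h1 := binomialMean_comp_distToIp_pos (g := 1) (a := 0) (b := m + 1) hn hq
    (by simp) (by omega) (by simp) hp (by simpa using hd)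
  rw [one_mul] at h1
  have h2 := sq_eval_zero_le hq hm (degree_comp_distToIp_lt hd n)
  rw [← mul_comp, eval_comp, eval_distToIp] at h2
  simp only [mul_zero, zero_div, sub_zero] at h2
  have hM' : ((∑ i ∈ range (m + 1), n.choose i * (q - 1) ^ i : ℕ) : ℝ) < M := by exact_mod_cast hM
  have h3 := mul_lt_mul_of_pos_right hM' h1
  rw [quadratureFunctional_apply, eval_mul, ← pow_two (eval 1 p), sub_pos, div_lt_iff₀ hM0]
  linarith

lemma two_mul_div_le_two {n z : ℕ} (hn : 0 < n) (hz : z ≤ n) : 2 * (z : ℝ) / n ≤ 2 := by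
  have h1 : (0 : ℝ) < n := by positivity
  have h2 : (z : ℝ) ≤ n := by exact_mod_cast hz
  rw [div_le_iff₀ h1]
  linarith

lemma two_mul_div_lt_two {n z : ℕ} (hz : z < n) : 2 * (z : ℝ) / n < 2 := by
  have h1 : (0 : ℝ) < n := by exact_mod_cast (by omega : 0 < n)
  have h2 : (z : ℝ) < n := by exact_mod_cast hz
  rw [div_lt_iff₀ h1]
  linarith

lemma quadratureFunctional_one_sub_X_pos {n q : ℕ} (M : ℕ) (hn : 0 < n) (hq : 2 ≤ q) {p : ℝ[X]}
    (hp : p ≠ 0) (hd : p.degree < n) :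
    0 < quadratureFunctional n q M ((1 - X) * (p * p)) := by
  rw [quadratureFunctional_apply, eval_mul]
  simp only [eval_sub, eval_one, eval_X, sub_self, zero_mul, zero_div, sub_zero]
  -- The weight `1 - t` vanishes at `z = 0`, leaving `n` points for the zero count.
  refine binomialMean_comp_distToIp_pos (a := 1) (b := n + 1) hn hq (fun z hz => ?_) le_rfl
    (fun z hz _ => ?_) hp (by simpa using hd)
  · simp only [eval_sub, eval_one, eval_X, sub_sub_cancel]
    positivity
  · simp only [eval_sub, eval_one, eval_X, sub_sub_cancel]
    have : (0 : ℝ) < z := by exact_mod_cast hz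
    positivity

lemma quadratureFunctional_one_sub_X_mul_one_add_X_pos {n q : ℕ} (M : ℕ) (hn : 0 < n) (hq : 2 ≤ q)
    {p : ℝ[X]} (hp : p ≠ 0) (hd : p.degree < (n - 1 : ℕ)) :
    0 < quadratureFunctional n q M ((1 - X) * (1 + X) * (p * p)) := by
  rw [quadratureFunctional_apply, eval_mul, eval_mul]
  simp only [eval_sub, eval_one, eval_X, sub_self, zero_mul, zero_div, sub_zero]
  -- Here both ends `z = 0` and `z = n` are lost, leaving `n - 1` points.
  refine binomialMean_comp_distToIp_pos (a := 1) (b := n) hn hq (fun z hz => ?_) (by omega)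
    (fun z hz hzn => ?_) hp hd
  · simp only [eval_mul, eval_add, eval_sub, eval_one, eval_X, sub_sub_cancel]
    have := two_mul_div_le_two hn hz
    exact mul_nonneg (by positivity) (by linarith)
  · simp only [eval_mul, eval_add, eval_sub, eval_one, eval_X, sub_sub_cancel]
    have := two_mul_div_lt_two hzn
    have : (0 : ℝ) < z := by exact_mod_cast hz
    exact mul_pos (by positivity) (by linarith)

/-- The distribution with density `1 + t` with respect to the binomial distribution is, up to a
constant, the binomial distribution with one trial less. -/
lemma binomialMean_succ_one_add_X_mul {N q : ℕ} (hq : 2 ≤ q) (g : ℝ[X]) :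
    binomialMean (N + 1) q (((1 + X) * g).comp (distToIp (N + 1)))
      = 2 / q * binomialMean N q (g.comp (distToIp (N + 1))) := by
  have hq0 : (q : ℝ) ≠ 0 := by
    have : q ≠ 0 := by omega
    positivity
  have hN : ((N + 1 : ℕ) : ℝ) ≠ 0 := by positivity
  rw [binomialMean_apply, binomialMean_apply, sum_range_succ]
  have hlast : (((1 + X) * g).comp (distToIp (N + 1))).eval ((N + 1 : ℕ) : ℝ) = 0 := by
    rw [eval_comp, eval_distToIp, eval_mul, mul_div_assoc, div_self hN]
    simp only [eval_add, eval_one, eval_X]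
    ring
  rw [hlast, mul_zero, add_zero, mul_sum, mul_sum, mul_sum]
  refine sum_congr rfl fun z hz => ?_
  have hz : z ≤ N := by rw [mem_range] at hz; omega
  have h1 : ((N + 1).choose z : ℝ) * ((N : ℝ) + 1 - z) = N.choose z * ((N : ℝ) + 1) := by
    have := Nat.choose_mul_succ_eq N z
    have h2 := congrArg (Nat.cast (R := ℝ)) this
    push_cast [Nat.cast_sub (show z ≤ N + 1 by omega)] at h2
    linarith
  have h2 : ((1 + X) * g).eval (1 - 2 * (z : ℝ) / (N + 1 : ℕ))
      = 2 * ((N : ℝ) + 1 - z) / (N + 1 : ℕ) * g.eval (1 - 2 * (z : ℝ) / (N + 1 : ℕ)) := by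
    rw [eval_mul]
    simp only [eval_add, eval_one, eval_X]
    congr 1
    field_simp
    push_cast
    ring
  rw [eval_comp, eval_comp, eval_distToIp, h2, pow_succ]
  have h3 : ((N + 1).choose z : ℝ) * (2 * ((N : ℝ) + 1 - z) / (N + 1 : ℕ)) = 2 * N.choose z := by
    push_cast at hN ⊢
    field_simp
    linarith
  calc _ = ((q : ℝ) ^ N * q)⁻¹ * ((((N + 1).choose z : ℝ) * (2 * ((N : ℝ) + 1 - z) / (N + 1 : ℕ)))
        * ((q : ℝ) - 1) ^ z * g.eval (1 - 2 * (z : ℝ) / (N + 1 : ℕ))) := by ring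
    _ = _ := by rw [h3, mul_inv]; ring

/-- After passing to `n - 1` trials the Christoffel bound applies; the factors `2/q` from the change
of law and `1 + t = 2` at `t = 1` account for the `q` in the odd Rao bound. -/
lemma quadratureFunctional_one_add_X_pos {n q M m : ℕ} (hq : 2 ≤ q) (hm : m < n)
    (hM : q * ∑ i ∈ range (m + 1), (n - 1).choose i * (q - 1) ^ i < M) {p : ℝ[X]} (hp : p ≠ 0)
    (hd : p.degree < (m + 1 : ℕ)) : 0 < quadratureFunctional n q M ((1 + X) * (p * p)) := by
  obtain ⟨N, rfl⟩ : ∃ N, n = N + 1 := ⟨n - 1, by omega⟩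
  rw [Nat.add_sub_cancel] at hM
  have hq0 : (0 : ℝ) < q := by exact_mod_cast (by omega : 0 < q)
  have hM0 : (0 : ℝ) < M := by exact_mod_cast lt_of_le_of_lt (Nat.zero_le _) hM
  have h1 := binomialMean_comp_distToIp_pos (g := 1 + X) (a := 0) (b := m + 1) N.succ_pos hq
    (fun z hz => by
      have := two_mul_div_le_two N.succ_pos hz
      simp only [eval_add, eval_one, eval_X]; linarith) (by omega)
    (fun z _ hz => by
      have := two_mul_div_lt_two (n := N + 1) (z := z) (by omega)
      simp only [eval_add, eval_one, eval_X]; linarith) hp (by simpa using hd)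
  rw [binomialMean_succ_one_add_X_mul hq] at h1
  have h1' : 0 < binomialMean N q ((p * p).comp (distToIp (N + 1))) :=
    pos_of_mul_pos_right h1 (by positivity)
  have h2 := sq_eval_zero_le (n := N) hq (by omega) (degree_comp_distToIp_lt hd (N + 1))
  rw [← mul_comp, eval_comp, eval_distToIp] at h2
  simp only [mul_zero, zero_div, sub_zero] at h2
  have hM' : (q : ℝ) * (∑ i ∈ range (m + 1), N.choose i * (q - 1) ^ i : ℕ) < M := by
    exact_mod_cast hM
  have h3 := mul_lt_mul_of_pos_right hM' h1'
  have h4 := mul_le_mul_of_nonneg_left h2 hq0.le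
  rw [quadratureFunctional_apply, binomialMean_succ_one_add_X_mul hq, eval_mul, eval_mul,
    ← pow_two (eval 1 p), sub_pos, div_lt_iff₀ hM0]
  simp only [eval_add, eval_one, eval_X]
  rw [div_mul_eq_mul_div, div_mul_eq_mul_div, lt_div_iff₀ hq0]
  linarith

end Positivity

/-! ### The two quadrature formulas. -/

section Quadrature

lemma natDegree_le_pred_iff {m : ℕ} (hm : 0 < m) (f : ℝ[X]) :
    f.natDegree ≤ m - 1 ↔ f.degree < m := by
  rcases eq_or_ne f 0 with rfl | hf
  · simp only [natDegree_zero, zero_le, degree_zero, true_iff]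
    exact WithBot.bot_lt_coe m
  · rw [degree_eq_natDegree hf]
    norm_cast
    omega

lemma krawtchoukCoeff_zero_eq_iff {n q M : ℕ} (hn : 0 < n) (hq : 2 ≤ q) (f : ℝ[X]) (s : ℝ) :
    krawtchoukCoeff n q f 0 = f.eval 1 / M + s ↔ quadratureFunctional n q M f = s := by
  rw [quadratureFunctional_apply, krawtchoukCoeff_zero hn hq, sub_eq_iff_eq_add, add_comm s]

/-- Positivity with weight `1` makes the Gauss weights positive; positivity with weights `1 + t` and
`1 - t` then places the nodes strictly inside the interval. -/
theorem existsUnique_oddQuadrature {n q M k : ℕ} (hq : 2 ≤ q) (hk : 0 < k) (hkn : k < n)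
    (hM : q * ∑ i ∈ range k, (n - 1).choose i * (q - 1) ^ i < M) :
    ∃! p : (Fin k → ℝ) × (Fin k → ℝ), IsOddQuadrature n q M k p.1 p.2 := by
  have hn : 0 < n := by omega
  obtain ⟨m, rfl⟩ : ∃ m, k = m + 1 := ⟨k - 1, by omega⟩
  set Λ := quadratureFunctional n q M
  have hplus : ∀ p : ℝ[X], p ≠ 0 → p.degree < (m + 1 : ℕ) → 0 < Λ ((1 + X) * (p * p)) :=
    fun p hp hd => quadratureFunctional_one_add_X_pos hq (by omega) hM hp hd
  have hminus : ∀ p : ℝ[X], p ≠ 0 → p.degree < (m + 1 : ℕ) → 0 < Λ ((1 - X) * (p * p)) :=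
    fun p hp hd => quadratureFunctional_one_sub_X_pos M hn hq hp
      (hd.trans (by exact_mod_cast hkn))
  have hpos : ∀ p : ℝ[X], p ≠ 0 → p.degree < (m + 1 : ℕ) → 0 < Λ (p * p) := by
    intro p hp hd
    have h1 := add_pos (hplus p hp hd) (hminus p hp hd)
    -- Positivity on squares comes for free from `2 = (1 + t) + (1 - t)`.
    rw [← map_add, show (1 + X) * (p * p) + (1 - X) * (p * p) = (2 : ℝ) • (p * p) by
      rw [smul_eq_C_mul, map_ofNat]; ring, map_smul, smul_eq_mul] at h1
    linarith
  have hiff : ∀ α ρ : Fin (m + 1) → ℝ,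
      (∀ f : ℝ[X], f.natDegree ≤ 2 * (m + 1) - 1 →
        krawtchoukCoeff n q f 0 = f.eval 1 / M + ∑ i, ρ i * f.eval (α i)) ↔
      ∀ f : ℝ[X], f.degree < (2 * (m + 1) : ℕ) → Λ f = ∑ i, ρ i * f.eval (α i) := fun α ρ =>
    forall_congr' fun f => by
      rw [krawtchoukCoeff_zero_eq_iff hn hq, natDegree_le_pred_iff (by omega)]
  obtain ⟨α, ρ, hα, hquad⟩ := exists_gauss_quadrature hpos
  have hρ : ∀ i, 0 < ρ i := fun i => by
    simpa using weight_mul_eval_pos hα hquad (g := 1) (by simp) (by simpa using hpos) i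
  refine ⟨(α, ρ), ⟨hα, fun i => ?_, hρ, (hiff α ρ).2 hquad⟩, ?_⟩
  · have h1 := weight_mul_eval_pos hα hquad (g := 1 + X) (by compute_degree) hplus i
    have h2 := weight_mul_eval_pos hα hquad (g := 1 - X) (by compute_degree) hminus i
    have h1 := pos_of_mul_pos_right h1 (hρ i).le
    have h2 := pos_of_mul_pos_right h2 (hρ i).le
    simp only [eval_add, eval_sub, eval_one, eval_X] at h1 h2
    constructor <;> linarith
  · rintro ⟨α', ρ'⟩ ⟨hα', -, -, hquad'⟩
    obtain ⟨h1, h2⟩ := gauss_quadrature_unique hpos hα' hα ((hiff _ _).1 hquad') hquad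
    exact Prod.ext h1 h2

/-- A quadrature formula of degree `2k` with the node `-1`, as a formula for `g ↦ Λ ((1 + X) g)`. -/
lemma quadrature_one_add_X_mul {Λ : ℝ[X] →ₗ[ℝ] ℝ} {k : ℕ} {β γ : Fin (k + 1) → ℝ} (h0 : β 0 = -1)
    (hquad : ∀ f : ℝ[X], f.degree < (2 * k + 1 : ℕ) → Λ f = ∑ i, γ i * f.eval (β i))
    {g : ℝ[X]} (hg : g.degree < (2 * k : ℕ)) :
    Λ ((1 + X) * g) = ∑ i : Fin k, γ i.succ * (1 + β i.succ) * g.eval (β i.succ) := by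
  rw [hquad, Fin.sum_univ_succ, h0]
  · simp [mul_assoc]
  · rcases eq_or_ne g 0 with rfl | hg0
    · simp only [mul_zero, degree_zero]; exact WithBot.bot_lt_coe _
    · have h1 : (1 + X : ℝ[X]).degree ≤ 1 := by compute_degree
      refine lt_of_le_of_lt (degree_mul_le_of_le h1 le_rfl) ?_
      rw [degree_eq_natDegree hg0] at hg ⊢
      norm_cast at hg ⊢
      omega

/-- A formula for `Λ` with a node at `-1` corresponds to a Gauss formula for `g ↦ Λ((1+t)g)`, the
weights being multiplied by `1 + t`. -/
theorem existsUnique_evenQuadrature {n q M k : ℕ} (hq : 2 ≤ q) (hkn : k < n)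
    (hM : ∑ i ∈ range (k + 1), n.choose i * (q - 1) ^ i < M) :
    ∃! p : (Fin (k + 1) → ℝ) × (Fin (k + 1) → ℝ), IsEvenQuadrature n q M k p.1 p.2 := by
  have hn : 0 < n := by omega
  set Λ := quadratureFunctional n q M
  let Λ' : ℝ[X] →ₗ[ℝ] ℝ := Λ ∘ₗ LinearMap.mulLeft ℝ (1 + X)
  have hΛ' : ∀ g, Λ' g = Λ ((1 + X) * g) := fun g => rfl
  have hsq : ∀ p : ℝ[X], p ≠ 0 → p.degree < (k + 1 : ℕ) → 0 < Λ (p * p) :=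
    fun p hp hd => quadratureFunctional_sq_pos hn hq hkn.le hM hp hd
  have hX : (1 + X : ℝ[X]) ≠ 0 := by
    intro h
    have := congrArg (eval 0) h
    simp at this
  have hplus : ∀ p : ℝ[X], p ≠ 0 → p.degree < (k : ℕ) → 0 < Λ' ((1 + X) * (p * p)) := by
    intro p hp hd
    rw [hΛ', show (1 + X) * ((1 + X) * (p * p)) = ((1 + X) * p) * ((1 + X) * p) by ring]
    refine hsq _ (mul_ne_zero hX hp) ?_
    have h1 : (1 + X : ℝ[X]).degree ≤ 1 := by compute_degree
    refine lt_of_le_of_lt (degree_mul_le_of_le h1 le_rfl) ?_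
    rw [degree_eq_natDegree hp] at hd ⊢
    norm_cast at hd ⊢
    omega
  have hminus : ∀ p : ℝ[X], p ≠ 0 → p.degree < (k : ℕ) → 0 < Λ' ((1 - X) * (p * p)) := by
    intro p hp hd
    rw [hΛ', show (1 + X) * ((1 - X) * (p * p)) = (1 - X) * (1 + X) * (p * p) by ring]
    exact quadratureFunctional_one_sub_X_mul_one_add_X_pos M hn hq hp
      (hd.trans_le (by norm_cast; omega))
  have hpos : ∀ p : ℝ[X], p ≠ 0 → p.degree < (k : ℕ) → 0 < Λ' (p * p) := by
    intro p hp hd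
    have h1 := add_pos (hplus p hp hd) (hminus p hp hd)
    rw [← map_add, show (1 + X) * (p * p) + (1 - X) * (p * p) = (2 : ℝ) • (p * p) by
      rw [smul_eq_C_mul, map_ofNat]; ring, map_smul, smul_eq_mul] at h1
    linarith
  have hiff : ∀ β γ : Fin (k + 1) → ℝ,
      (∀ f : ℝ[X], f.natDegree ≤ 2 * k →
        krawtchoukCoeff n q f 0 = f.eval 1 / M + ∑ i, γ i * f.eval (β i)) ↔
      ∀ f : ℝ[X], f.degree < (2 * k + 1 : ℕ) → Λ f = ∑ i, γ i * f.eval (β i) := fun β γ =>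
    forall_congr' fun f => by
      rw [krawtchoukCoeff_zero_eq_iff hn hq, ← natDegree_le_pred_iff (by omega),
        Nat.add_sub_cancel]
  obtain ⟨α, ρ, hα, hquad⟩ := exists_gauss_quadrature hpos
  have hρ : ∀ i, 0 < ρ i := fun i => by
    simpa using weight_mul_eval_pos hα hquad (g := 1) (by simp) (by simpa using hpos) i
  have hα1 : ∀ i, 0 < 1 + α i := fun i => by
    have h1 := weight_mul_eval_pos hα hquad (g := 1 + X) (by compute_degree) hplus i
    simpa using pos_of_mul_pos_right h1 (hρ i).le
  have hα2 : ∀ i, α i < 1 := fun i => by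
    have h2 := weight_mul_eval_pos hα hquad (g := 1 - X) (by compute_degree) hminus i
    simpa using pos_of_mul_pos_right h2 (hρ i).le
  -- The weight at `-1` is forced by exactness on constants.
  set γ₀ := Λ 1 - ∑ i, ρ i / (1 + α i) with hγ₀
  have hfull : ∀ f : ℝ[X], f.degree < (2 * k + 1 : ℕ) →
      Λ f = γ₀ * f.eval (-1) + ∑ i, ρ i / (1 + α i) * f.eval (α i) := by
    intro f hf
    obtain ⟨g, hg⟩ := X_sub_C_dvd_sub_C_eval (a := (-1 : ℝ)) (p := f)
    have hfg : f = f.eval (-1) • 1 + (1 + X) * g := by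
      rw [sub_eq_iff_eq_add] at hg
      rw [smul_eq_C_mul, mul_one]
      conv_lhs => rw [hg]
      simp only [C_neg, C_1]
      ring
    have hgd : g.degree < (2 * k : ℕ) := by
      rcases eq_or_ne g 0 with rfl | hg0
      · rw [degree_zero]; exact WithBot.bot_lt_coe _
      · have h1 : (f - C (f.eval (-1))).degree < (2 * k + 1 : ℕ) :=
          lt_of_le_of_lt (degree_sub_le _ _) (max_lt hf
            (lt_of_le_of_lt degree_C_le (by norm_cast; omega)))
        rw [hg, degree_mul, degree_X_sub_C] at h1
        rw [degree_eq_natDegree hg0] at h1 ⊢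
        norm_cast at h1 ⊢
        omega
    have h2 := hquad g hgd
    rw [hΛ'] at h2
    have h3 : ∀ i, ρ i / (1 + α i) * f.eval (α i)
        = f.eval (-1) * (ρ i / (1 + α i)) + ρ i * g.eval (α i) := fun i => by
      conv_lhs => rw [hfg]
      have := (hα1 i).ne'
      simp only [eval_add, eval_smul, eval_mul, eval_one, eval_X, smul_eq_mul]
      field_simp
    rw [sum_congr rfl fun i _ => h3 i, sum_add_distrib, ← mul_sum, ← h2]
    conv_lhs => rw [hfg]
    rw [map_add, map_smul, smul_eq_mul, hγ₀]
    ring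
  -- The square of the nodal polynomial has degree `2k` and vanishes at every node but `-1`, so `Λ`
  -- of it isolates `γ₀`.
  have hγ₀pos : 0 < γ₀ := by
    have hd : (Lagrange.nodal univ α).degree < (k + 1 : ℕ) := by
      rw [Lagrange.degree_nodal, card_univ, Fintype.card_fin]; norm_cast; omega
    have h1 := hsq _ Lagrange.nodal_ne_zero hd
    rw [hfull, sum_eq_zero, add_zero, eval_mul] at h1
    · exact pos_of_mul_pos_left h1 (mul_self_nonneg _)
    · intro i _
      simp [Lagrange.eval_nodal_at_node (mem_univ i)]
    · rw [degree_mul, Lagrange.degree_nodal, card_univ, Fintype.card_fin]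
      norm_cast
      omega
  refine ⟨(Fin.cons (-1) α, Fin.cons γ₀ fun i => ρ i / (1 + α i)), ⟨?_, rfl, ?_, ?_, ?_⟩, ?_⟩
  · intro i j hij
    induction j using Fin.cases with
    | zero => exact absurd hij (Fin.not_lt_zero i)
    | succ j =>
      induction i using Fin.cases with
      | zero => simpa using (by linarith [hα1 j] : -1 < α j)
      | succ i => simpa using hα (Fin.succ_lt_succ_iff.1 hij)
  · intro i
    induction i using Fin.cases with
    | zero => norm_num
    | succ i => simpa using hα2 i
  · intro i
    induction i using Fin.cases with
    | zero => simpa using hγ₀pos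
    | succ i => simpa using div_pos (hρ i) (hα1 i)
  · refine (hiff _ _).2 fun f hf => ?_
    rw [hfull f hf, Fin.sum_univ_succ]
    simp
  · rintro ⟨β, γ⟩ ⟨hβ, hβ0, -, -, hquad'⟩
    have hβ : StrictMono β := hβ
    have hβ0 : β 0 = -1 := hβ0
    have hquad' := (hiff _ _).1 hquad'
    obtain ⟨h1, h2⟩ := gauss_quadrature_unique (Λ := Λ') (α := fun i => β i.succ)
      (ρ := fun i => γ i.succ * (1 + β i.succ)) hpos
      (hβ.comp (Fin.strictMono_succ)) hα
      (fun g hg => quadrature_one_add_X_mul hβ0 hquad' hg) hquad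
    have h1' : ∀ i, β i.succ = α i := congrFun h1
    have h2' : ∀ i, γ i.succ = ρ i / (1 + α i) := fun i => by
      have := congrFun h2 i
      simp only [h1'] at this
      rw [← this, mul_div_cancel_right₀ _ (hα1 i).ne']
    have h3 : γ 0 = γ₀ := by
      have h4 := hquad' 1 (by rw [degree_one]; norm_cast; omega)
      rw [Fin.sum_univ_succ] at h4
      simp only [eval_one, mul_one, h2'] at h4
      linarith
    refine Prod.ext (funext fun i => ?_) (funext fun i => ?_)
    · induction i using Fin.cases with
      | zero => exact hβ0
      | succ i => simpa using h1' i
    · induction i using Fin.cases with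
      | zero => exact h3
      | succ i => simpa using h2' i

end Quadrature

/-! ### Comparing the Rao bounds with the size of the space. -/

section RaoBound

lemma sum_range_choose_mul_pow_le {q : ℕ} (hq : 2 ≤ q) (N m : ℕ) :
    ∑ i ∈ range m, N.choose i * (q - 1) ^ i ≤ q ^ N := by
  have h1 : q ^ N = ∑ i ∈ range (N + 1), N.choose i * (q - 1) ^ i := by
    conv_lhs => rw [show q = (q - 1) + 1 by omega, add_pow]
    exact sum_congr rfl fun i _ => by rw [one_pow, mul_one, mul_comm]; rfl
  have h2 : ∑ i ∈ range (N + 1), N.choose i * (q - 1) ^ i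
      = ∑ i ∈ range (max m (N + 1)), N.choose i * (q - 1) ^ i := by
    refine sum_subset (range_mono (le_max_right _ _)) fun i _ hi => ?_
    rw [mem_range] at hi
    rw [Nat.choose_eq_zero_of_lt (by omega), zero_mul]
  rw [h1, h2]
  exact sum_le_sum_of_subset (range_mono (le_max_left _ _))

lemma le_sum_range_choose_mul_pow {q : ℕ} (hq : 2 ≤ q) {N m : ℕ} (h : N < m) :
    q ^ N ≤ ∑ i ∈ range m, N.choose i * (q - 1) ^ i := by
  conv_lhs => rw [show q = (q - 1) + 1 by omega, add_pow]
  refine le_trans (le_of_eq ?_) (sum_le_sum_of_subset (range_mono h))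
  exact sum_congr rfl fun i _ => by rw [one_pow, mul_one, mul_comm]; rfl

lemma raoBound_even (n q k : ℕ) :
    raoBound n q (2 * k) = ∑ i ∈ range (k + 1), n.choose i * (q - 1) ^ i := by
  rw [raoBound, if_pos (even_two_mul k), Nat.mul_div_cancel_left k two_pos]

lemma raoBound_odd (n q k : ℕ) :
    raoBound n q (2 * k + 1) = q * ∑ i ∈ range (k + 1), (n - 1).choose i * (q - 1) ^ i := by
  rw [raoBound, if_neg (by simp), show (2 * k + 1 + 1) / 2 = k + 1 by omega]

lemma raoBound_le {n q : ℕ} (hn : 0 < n) (hq : 2 ≤ q) (τ : ℕ) : raoBound n q τ ≤ q ^ n := by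
  rw [raoBound]
  split_ifs
  · exact sum_range_choose_mul_pow_le hq _ _
  · calc _ ≤ q * q ^ (n - 1) := Nat.mul_le_mul_left _ (sum_range_choose_mul_pow_le hq _ _)
      _ = q ^ n := mul_pow_sub_one hn.ne' q

end RaoBound

/-! ### From quadrature and an interpolating minorant to the optimal bound. -/

section Optimality

/-- A quadrature formula for a class of polynomials together with an interpolating minorant of `h`
in that class gives a bound for the energy that is optimal in that class. -/
theorem energy_bound_of_quadrature {n q M τ m : ℕ} (hn : 0 < n) (hq : 2 ≤ q) (hM : 0 < M)
    {h : ℝ → ℝ} {α ρ : Fin m → ℝ} (hα : ∀ i, α i ∈ Set.Ico (-1 : ℝ) 1) (hρ : ∀ i, 0 < ρ i)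
    (hquad : ∀ f : ℝ[X], f.natDegree ≤ τ →
      krawtchoukCoeff n q f 0 = f.eval 1 / M + ∑ i, ρ i * f.eval (α i))
    (hex : ∃ f : ℝ[X], f.natDegree ≤ τ ∧ (∀ t ∈ Set.Ico (-1 : ℝ) 1, f.eval t ≤ h t) ∧
      ∀ i, f.eval (α i) = h (α i)) :
    ((M * ∑ i, ρ i * h (α i) : ℝ) : EReal) ≤ minDesignEnergy n q M τ h ∧
      IsGreatest (linearProgramValues n q M τ h) (M * ∑ i, ρ i * h (α i)) := by
  have hM0 : (M : ℝ) ≠ 0 := by positivity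
  have hval : ∀ f : ℝ[X], f.natDegree ≤ τ →
      krawtchoukCoeff n q f 0 * M - f.eval 1 = M * ∑ i, ρ i * f.eval (α i) := fun f hf => by
    rw [hquad f hf]
    field_simp
    ring
  obtain ⟨f, hf, hfh, hfα⟩ := hex
  have hf1 : M * ∑ i, ρ i * h (α i) = krawtchoukCoeff n q f 0 * M - f.eval 1 := by
    rw [hval f hf]; simp only [hfα]
  refine ⟨le_iInf₂ fun C hC => ?_, ⟨f, hf, hfh, hf1⟩, ?_⟩
  · rw [EReal.coe_le_coe_iff, hf1, ← hC.1]
    exact hC.2.le_energy hn hq hf hfh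
  · rintro v ⟨g, hg, hgh, rfl⟩
    rw [hval g hg]
    refine mul_le_mul_of_nonneg_left (sum_le_sum fun i _ => ?_) (Nat.cast_nonneg M)
    exact mul_le_mul_of_nonneg_left (hgh _ (hα i)) (hρ i).le

end Optimality

end HammingEnergy

end

/-! ### The main theorem. -/

theorem mainTheorem2 (n q τ M : ℕ) (hn : 0 < n) (hq : 2 ≤ q) (hτ : 0 < τ) (h : ℝ → ℝ)
    (hh : AbsolutelyMonotoneOn h (Set.Ico (-1) 1)) :
    (∀ k : ℕ, τ = 2 * k - 1 →
      M ∈ Set.Ioc (HammingEnergy.raoBound n q (2 * k - 1)) (HammingEnergy.raoBound n q (2 * k)) →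
      (∃! p : (Fin k → ℝ) × (Fin k → ℝ), HammingEnergy.IsOddQuadrature n q M k p.1 p.2) ∧
      ∀ α ρ : Fin k → ℝ, HammingEnergy.IsOddQuadrature n q M k α ρ →
        ((M * ∑ i, ρ i * h (α i) : ℝ) : EReal) ≤ HammingEnergy.minDesignEnergy n q M τ h ∧
        (HammingEnergy.minDesignEnergy n q M τ h < ⊤ →
          IsGreatest (HammingEnergy.linearProgramValues n q M τ h)
            (M * ∑ i, ρ i * h (α i)))) ∧
    (∀ k : ℕ, τ = 2 * k →
      M ∈ Set.Ioc (HammingEnergy.raoBound n q (2 * k)) (HammingEnergy.raoBound n q (2 * k + 1)) →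
      (∃! p : (Fin (k + 1) → ℝ) × (Fin (k + 1) → ℝ),
        HammingEnergy.IsEvenQuadrature n q M k p.1 p.2) ∧
      ∀ β γ : Fin (k + 1) → ℝ, HammingEnergy.IsEvenQuadrature n q M k β γ →
        ((M * ∑ i, γ i * h (β i) : ℝ) : EReal) ≤ HammingEnergy.minDesignEnergy n q M τ h ∧
        (HammingEnergy.minDesignEnergy n q M τ h < ⊤ →
          IsGreatest (HammingEnergy.linearProgramValues n q M τ h)
            (M * ∑ i, γ i * h (β i)))) := by
  constructor
  · rintro k rfl ⟨hM1, hM2⟩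
    have hk : 0 < k := by omega
    have hM : q * ∑ i ∈ range k, (n - 1).choose i * (q - 1) ^ i < M := by
      have := HammingEnergy.raoBound_odd n q (k - 1)
      rw [show 2 * (k - 1) + 1 = 2 * k - 1 by omega, show k - 1 + 1 = k by omega] at this
      rwa [this] at hM1
    -- If `k ≥ n`, the sum in `R(n,2k-1)` is a complete binomial expansion, so `R(n,2k-1) ≥ q^n ≥
    -- R(n,2k)` and no `M` lies in the interval.
    have hkn : k < n := by
      by_contra! hle
      have h1 := HammingEnergy.le_sum_range_choose_mul_pow hq (show n - 1 < k by omega)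
      have h2 := Nat.mul_le_mul_left q h1
      rw [mul_pow_sub_one hn.ne'] at h2
      have h3 := HammingEnergy.raoBound_le hn hq (2 * k)
      omega
    refine ⟨HammingEnergy.existsUnique_oddQuadrature hq hk hkn hM, ?_⟩
    rintro α ρ ⟨-, hα, hρ, hquad⟩
    obtain ⟨f, hf, hfh⟩ := HammingEnergy.exists_le_of_double_nodes hh α hα
    have key := HammingEnergy.energy_bound_of_quadrature hn hq (by omega)
      (fun i => ⟨(hα i).1.le, (hα i).2⟩) hρ hquad
      ⟨f, (HammingEnergy.natDegree_le_pred_iff (by omega) f).2 hf, hfh⟩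
    exact ⟨key.1, fun _ => key.2⟩
  · rintro k rfl ⟨hM1, hM2⟩
    have hM := hM1
    rw [HammingEnergy.raoBound_even] at hM
    -- Likewise `k ≥ n` would give `R(n,2k) ≥ q^n ≥ R(n,2k+1)`.
    have hkn : k < n := by
      by_contra! hle
      have h1 := HammingEnergy.le_sum_range_choose_mul_pow hq (show n < k + 1 by omega)
      have h3 := HammingEnergy.raoBound_le hn hq (2 * k + 1)
      omega
    refine ⟨HammingEnergy.existsUnique_evenQuadrature hq hkn hM, ?_⟩
    rintro β γ ⟨hβ, hβ0, hβ1, hγ, hquad⟩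
    have hβgt : ∀ i : Fin k, β i.succ ∈ Set.Ioo (-1 : ℝ) 1 := fun i =>
      ⟨hβ0 ▸ hβ (Fin.succ_pos i), hβ1 _⟩
    obtain ⟨f, hf, hfh, hf0, hfβ⟩ :=
      HammingEnergy.exists_le_of_neg_one_of_double_nodes hh (fun i : Fin k => β i.succ) hβgt
    have key := HammingEnergy.energy_bound_of_quadrature hn hq (by omega)
      (fun i => ⟨hβ0 ▸ hβ.monotone (Fin.zero_le i), hβ1 i⟩) hγ hquad
      ⟨f, (HammingEnergy.natDegree_le_pred_iff (m := 2 * k + 1) (by omega) f).2 hf, hfh, fun i => by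
        induction i using Fin.cases with
        | zero => rw [hβ0, hf0]
        | succ i => exact hfβ i⟩
    exact ⟨key.1, fun _ => key.2⟩
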